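/- Let $\alpha^+,\lambda^+,\alpha^-,\lambda^->0$. Let $f$ be the density of the bilateral Gamma distribution, i.e. of the law of $X-Y$ with $X\sim\Gamma(\alpha^+,\lambda^+)$ and $Y\sim\Gamma(\alpha^-,\lambda^-)$ independent (shape, rate); explicitly, $$f(x)=\int_{\mathbb R} g_{\alpha^+,\lambda^+}(x+y)\,g_{\alpha^-,\lambda^-}(y)\,dy,\qquad g_{a,r}(t)=\frac{r^a}{\Gamma(a)}t^{a-1}e^{-rt}\mathbf 1_{\{t>0\}}.$$ Let $N=\lceil\alpha^++\alpha^-\rceil-1$ and $\mathbb N=\{1,2,\dots\}$. Then $f\in C^N(\mathbb R\setminus\{0\})$, and: 1. The limit $\lim_{x\downarrow0}f^{(N)}(x)$ exists and is finite if and only if $\alpha^+\in\mathbb N$. 2. If $\alpha^+\notin\mathbb N$ and $\alpha^++\alpha^-\notin\mathbb N$, then $f^{(N)}(x)\sim C_1x^{-\alpha}$ as $x\downarrow0$, where $\alpha=N+1-\alpha^+-\alpha^-\in(0,1)$ and $$C_1=\frac{(\lambda^+)^{\alpha^+}(\lambda^-)^{\alpha^-}\sin(\alpha^+\pi)}{\Gamma(\alpha^++\alpha^--N)\,\sin((\alpha^++\alpha^-)\pi)}\neq0.$$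 3. If $\alpha^+\notin\mathbb N$ and $\alpha^++\alpha^-\in\mathbb N$, then $f^{(N)}(x)\sim(-1)^{\lfloor\alpha^-\rfloor}M(x)$ as $x\to0$ (from both sides), where $M:\mathbb R\to\mathbb R$ is slowly varying as $x\to0$ (measurable, positive for all sufficiently small $x\neq0$, and $M(cx)/M(x)\to1$ as $x\to0$ for every $c>0$) and $\lim_{x\to0}M(x)=\infty$. Moreover $$\lim_{x\downarrow0}\bigl(f^{(N)}(x)-f^{(N)}(-x)\bigr)=C_2=\frac{(\lambda^+)^{\alpha^+}(\lambda^-)^{\alpha^-}}2\Bigl((-1)^{N+1}\cos(\alpha^+\pi)+\cos(\alpha^-\pi)\Bigr).$$ -/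

import Mathlib

open MeasureTheory ProbabilityTheory Filter Topology Asymptotics

/-- The bilateral Gamma distribution: the law of `X - Y`, where `X` and `Y` are independent,
`X ∼ Γ(αp, lp)` and `Y ∼ Γ(αm, lm)` (shape, rate). -/
noncomputable def bilateralGammaMeasure (αp lp αm lm : ℝ) : Measure ℝ :=
  ((gammaMeasure αp lp).prod (gammaMeasure αm lm)).map (fun p : ℝ × ℝ => p.1 - p.2)

/-- The density of the bilateral Gamma distribution, as the convolution of the density of `X`
with that of `-Y`. -/
noncomputable def bilateralGammaPDF (αp lp αm lm : ℝ) (x : ℝ) : ℝ :=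
  ∫ y, gammaPDFReal αp lp (x + y) * gammaPDFReal αm lm y

/-- The order `N = ⌈αp + αm⌉ - 1` of the first discontinuous derivative of the density. -/
noncomputable def bilateralGammaOrder (αp αm : ℝ) : ℕ := ⌈αp + αm⌉₊ - 1

/-- The constant in the power-law asymptotics at zero. -/
noncomputable def bilateralGammaC₁ (αp lp αm lm : ℝ) : ℝ :=
  (lp ^ αp * lm ^ αm * Real.sin (αp * Real.pi)) /
    (Real.Gamma (αp + αm - bilateralGammaOrder αp αm) * Real.sin ((αp + αm) * Real.pi))

/-- The limiting difference between the two sides of zero. -/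
noncomputable def bilateralGammaC₂ (αp lp αm lm : ℝ) : ℝ :=
  (lp ^ αp * lm ^ αm) / 2 *
    ((-1) ^ (bilateralGammaOrder αp αm + 1) * Real.cos (αp * Real.pi)
      + Real.cos (αm * Real.pi))

/-- `M` is slowly varying as `x → 0` (from both sides). -/
def IsSlowlyVaryingAtZero (M : ℝ → ℝ) : Prop :=
  Measurable M ∧ (∀ᶠ x in 𝓝[≠] 0, 0 < M x) ∧
    ∀ c : ℝ, 0 < c → Tendsto (fun x => M (c * x) / M x) (𝓝[≠] 0) (𝓝 1)

/-- `bilateralGammaPDF` is indeed a Lebesgue density of the bilateral Gamma distribution. -/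
theorem bilateralGammaMeasure_eq_withDensity {αp lp αm lm : ℝ}
    (hαp : 0 < αp) (hlp : 0 < lp) (hαm : 0 < αm) (hlm : 0 < lm) :
    bilateralGammaMeasure αp lp αm lm =
      volume.withDensity (fun x => ENNReal.ofReal (bilateralGammaPDF αp lp αm lm x)) := by
  have mg : ∀ a r : ℝ, Measurable (gammaPDF a r) := fun a r =>
    (measurable_gammaPDFReal a r).ennreal_ofReal
  have := isProbabilityMeasure_gammaMeasure hαp hlp
  have := isProbabilityMeasure_gammaMeasure hαm hlm
  have hmeas : Measurable (fun p : ℝ × ℝ => gammaPDF αp lp (p.1 + p.2) * gammaPDF αm lm p.2) :=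
    ((mg αp lp).comp (measurable_fst.add measurable_snd)).mul ((mg αm lm).comp measurable_snd)
  have key : ∀ s : Set ℝ, MeasurableSet s → bilateralGammaMeasure αp lp αm lm s =
      ∫⁻ x in s, ∫⁻ y, gammaPDF αp lp (x + y) * gammaPDF αm lm y := by
    intro s hs
    have hsub : Measurable (fun p : ℝ × ℝ => p.1 - p.2) := measurable_fst.sub measurable_snd
    have hind : Measurable (s.indicator (1 : ℝ → ENNReal)) := measurable_one.indicator hs
    rw [bilateralGammaMeasure, ← lintegral_indicator_one hs, lintegral_map hind hsub,
      lintegral_prod_symm (fun p : ℝ × ℝ => s.indicator (1 : ℝ → ENNReal) (p.1 - p.2))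
        (hind.comp hsub).aemeasurable]
    have h1 : ∀ y : ℝ, ∫⁻ x, s.indicator (1 : ℝ → ENNReal) (x - y) ∂(gammaMeasure αp lp) =
        ∫⁻ x in s, gammaPDF αp lp (x + y) := by
      intro y
      have h0 : Measurable (fun x : ℝ => s.indicator (1 : ℝ → ENNReal) (x - y)) :=
        hind.comp (measurable_id.sub_const y)
      rw [gammaMeasure, lintegral_withDensity_eq_lintegral_mul _ (mg αp lp) h0, ← lintegral_add_right_eq_self _ y,
        ← lintegral_indicator hs]
      refine lintegral_congr fun x => ?_
      by_cases hx : x ∈ s <;> simp [hx]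
    simp only [h1]
    have h2 : Measurable (fun y : ℝ => ∫⁻ x in s, gammaPDF αp lp (x + y)) :=
      Measurable.lintegral_prod_left' (f := fun p : ℝ × ℝ => gammaPDF αp lp (p.1 + p.2))
        ((mg αp lp).comp (measurable_fst.add measurable_snd))
    rw [gammaMeasure, lintegral_withDensity_eq_lintegral_mul _ (mg αm lm) h2,
      lintegral_lintegral_swap hmeas.aemeasurable]
    refine lintegral_congr fun y => ?_
    have h3 : Measurable (fun x : ℝ => gammaPDF αp lp (x + y)) :=
      (mg αp lp).comp (measurable_add_const y)
    rw [Pi.mul_apply, mul_comm, lintegral_mul_const _ h3]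
  have hG : Measurable (fun x : ℝ => ∫⁻ y, gammaPDF αp lp (x + y) * gammaPDF αm lm y) :=
    hmeas.lintegral_prod_right'
  have hfin : ∀ᵐ x : ℝ, ∫⁻ y, gammaPDF αp lp (x + y) * gammaPDF αm lm y < ⊤ := by
    refine ae_lt_top hG ?_
    rw [← setLIntegral_univ, ← key _ MeasurableSet.univ, bilateralGammaMeasure,
      Measure.map_apply (f := fun p : ℝ × ℝ => p.1 - p.2)
        (measurable_fst.sub measurable_snd) MeasurableSet.univ]
    exact measure_ne_top _ _
  have hae : ∀ᵐ x : ℝ, ∫⁻ y, gammaPDF αp lp (x + y) * gammaPDF αm lm y =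
      ENNReal.ofReal (bilateralGammaPDF αp lp αm lm x) := by
    filter_upwards [hfin] with x hx
    have hnn : ∀ y, 0 ≤ gammaPDFReal αp lp (x + y) * gammaPDFReal αm lm y := fun y =>
      mul_nonneg (gammaPDFReal_nonneg hαp hlp _) (gammaPDFReal_nonneg hαm hlm _)
    have hm : Measurable (fun y => gammaPDFReal αp lp (x + y) * gammaPDFReal αm lm y) :=
      ((measurable_gammaPDFReal αp lp).comp (measurable_const_add x)).mul
        (measurable_gammaPDFReal αm lm)
    have heq : ∀ y, gammaPDF αp lp (x + y) * gammaPDF αm lm y =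
        ENNReal.ofReal (gammaPDFReal αp lp (x + y) * gammaPDFReal αm lm y) := fun y =>
      (ENNReal.ofReal_mul (gammaPDFReal_nonneg hαp hlp _)).symm
    simp only [heq] at hx ⊢
    rw [bilateralGammaPDF, integral_eq_lintegral_of_nonneg_ae (ae_of_all _ hnn)
      hm.aestronglyMeasurable, ENNReal.ofReal_toReal hx.ne]
  ext s hs
  rw [key s hs, withDensity_apply _ hs]
  exact lintegral_congr_ae (ae_restrict_of_ae hae)

/-! On `(0, ∞)` the density is a constant times `e^(-lp x) S(x)`, where `S` is the shifted Gamma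
integral with exponents `c = αp`, `b = αm`; exchanging the two variables reflects it to `(-∞, 0)`.
Write `F_c` for this function, `bilateralGammaSide`, with `c` any real. Differentiation gives `F_c'
= lp (F_(c-1) - F_c)`, so `N` derivatives produce a leading term `lp^N F_(αp-N)` plus terms with
larger first parameter, which stay bounded at zero because `N < αp + αm ≤ N + 1`.

It remains to know `F_c` near zero: a finite limit if `c + b > 1`, a multiple of `x^(c+b-1)` if `c +
b < 1` (a Beta integral), and a multiple of `-log x` if `c + b = 1`. The leading coefficient
contains `1 / Γ(αp - N)`, which is nonzero when `αp` is not an integer. For integer `αp` the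
recursion stops at `F_0 = 0`, and all limits are finite.

When `αp + αm` is an integer the logarithms on the two sides cancel, and the jump satisfies the
recursion of `bilateralGammaJump_succ`. This reduces it to `a + b = 1`, where the difference of the
two integrals tends to `π cot(π b)` by the partial fraction series of the cotangent
(`integral_rpow_sub_rpow_div_one_sub`). -/

/-! ### The shifted Gamma integral -/

/-- The integral `∫₀^∞ (x + y)^(c-1) y^(b-1) e^(-s y) dy`. -/
noncomputable def shiftedGammaIntegral (s c b x : ℝ) : ℝ :=
  ∫ y in Set.Ioi (0 : ℝ), (x + y) ^ (c - 1) * y ^ (b - 1) * Real.exp (-(s * y))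

theorem integrableOn_rpow_mul_exp_neg_mul {s b : ℝ} (hs : 0 < s) (hb : 0 < b) :
    IntegrableOn (fun y : ℝ => y ^ (b - 1) * Real.exp (-(s * y))) (Set.Ioi 0) := by
  have h := integrableOn_rpow_mul_exp_neg_mul_rpow (p := 1) (s := b - 1) (by linarith)
    one_pos hs
  refine h.congr_fun (fun y _ => ?_) measurableSet_Ioi
  simp

theorem measurable_shiftedGamma_integrand (s c b x : ℝ) :
    Measurable fun y : ℝ => (x + y) ^ (c - 1) * y ^ (b - 1) * Real.exp (-(s * y)) := by
  fun_prop

/-- The sign of `p` is unknown, so either endpoint may carry the maximum; their sum serves both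
cases as a dominating function. -/
theorem rpow_le_rpow_add_rpow_of_mem_Icc {u v w p : ℝ} (hu : 0 < u) (huv : u ≤ v) (hvw : v ≤ w) :
    v ^ p ≤ u ^ p + w ^ p := by
  have hv : 0 < v := hu.trans_le huv
  have hw : 0 < w := hv.trans_le hvw
  rcases le_total 0 p with hp | hp
  · have := Real.rpow_le_rpow hv.le hvw hp
    have := Real.rpow_pos_of_pos hu p
    linarith
  · have := Real.rpow_le_rpow_of_nonpos hu huv hp
    have := Real.rpow_pos_of_pos hw p
    linarith

theorem integrableOn_shiftedGamma {s b x : ℝ} (hs : 0 < s) (c : ℝ) (hb : 0 < b) (hx : 0 < x) :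
    IntegrableOn (fun y : ℝ => (x + y) ^ (c - 1) * y ^ (b - 1) * Real.exp (-(s * y)))
      (Set.Ioi 0) := by
  have h1 := (integrableOn_rpow_mul_exp_neg_mul hs hb).const_mul (x ^ (c - 1))
  have h2 := (integrableOn_rpow_mul_exp_neg_mul hs hb).const_mul ((2 * x) ^ (c - 1))
  have hbm : 0 < b + max (c - 1) 0 := by positivity
  have h3 := (integrableOn_rpow_mul_exp_neg_mul hs hbm).const_mul (2 ^ max (c - 1) 0)
  refine ((h1.add h2).add h3).mono' (measurable_shiftedGamma_integrand s c b x).aestronglyMeasurable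
    ((ae_restrict_iff' measurableSet_Ioi).2 (ae_of_all _ fun y hy => ?_))
  have hy : 0 < y := hy
  -- For `y ≤ x` the base lies in `[x, 2x]`. For `y ≥ x` it lies in `[x, 2y]`, and growth in `y`
  -- matters only if `c ≥ 1`; hence the exponent `max (c - 1) 0`.
  have key : (x + y) ^ (c - 1) ≤
      x ^ (c - 1) + (2 * x) ^ (c - 1) + 2 ^ max (c - 1) 0 * y ^ max (c - 1) 0 := by
    rcases le_total y x with hyx | hyx
    · have := rpow_le_rpow_add_rpow_of_mem_Icc (p := c - 1) hx (by linarith : x ≤ x + y)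
        (by linarith : x + y ≤ 2 * x)
      have : 0 ≤ 2 ^ max (c - 1) 0 * y ^ max (c - 1) 0 := by positivity
      linarith
    · have hx1 := Real.rpow_pos_of_pos hx (c - 1)
      have hx2 := Real.rpow_pos_of_pos (by positivity : 0 < 2 * x) (c - 1)
      have hm : 0 ≤ 2 ^ max (c - 1) 0 * y ^ max (c - 1) 0 := by positivity
      rcases le_total 0 (c - 1) with hc | hc
      · rw [max_eq_left hc, ← Real.mul_rpow (by norm_num) hy.le]
        have := Real.rpow_le_rpow (by positivity) (by linarith : x + y ≤ 2 * y) hc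
        linarith
      · have := Real.rpow_le_rpow_of_nonpos hx (by linarith : x ≤ x + y) hc
        linarith
  have hyp : y ^ (b + max (c - 1) 0 - 1) = y ^ max (c - 1) 0 * y ^ (b - 1) := by
    rw [← Real.rpow_add hy]; ring_nf
  rw [Real.norm_of_nonneg (by positivity)]
  simp only [Pi.add_apply]
  rw [hyp]
  have hE : 0 ≤ y ^ (b - 1) * Real.exp (-(s * y)) := by positivity
  nlinarith [mul_le_mul_of_nonneg_right key hE]

/-- For `x > 0` the factor `(x + y)^(c-1)` is not singular at `y = 0`, so `c` is unrestricted and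
the formula can be iterated indefinitely. -/
theorem hasDerivAt_shiftedGammaIntegral {s b x : ℝ} (hs : 0 < s) (c : ℝ) (hb : 0 < b)
    (hx : 0 < x) :
    HasDerivAt (shiftedGammaIntegral s c b) ((c - 1) * shiftedGammaIntegral s (c - 1) b x) x := by
  have hx2 : 0 < x / 2 := by positivity
  have hx3 : 0 < 2 * x := by positivity
  have h := (hasDerivAt_integral_of_dominated_loc_of_deriv_le
    (μ := volume.restrict (Set.Ioi (0 : ℝ)))
    (F := fun t y => (t + y) ^ (c - 1) * y ^ (b - 1) * Real.exp (-(s * y)))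
    (F' := fun t y => (c - 1) * ((t + y) ^ (c - 1 - 1) * y ^ (b - 1) * Real.exp (-(s * y))))
    (x₀ := x) (s := Set.Ioo (x / 2) (2 * x))
    (bound := fun y => |c - 1| * ((x / 2 + y) ^ (c - 1 - 1) * y ^ (b - 1) * Real.exp (-(s * y))
      + (2 * x + y) ^ (c - 1 - 1) * y ^ (b - 1) * Real.exp (-(s * y))))
    (Ioo_mem_nhds (by linarith) (by linarith))
    (Eventually.of_forall fun t => (measurable_shiftedGamma_integrand s c b t).aestronglyMeasurable)
    (integrableOn_shiftedGamma hs c hb hx)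
    ((measurable_shiftedGamma_integrand s (c - 1) b x).const_mul _).aestronglyMeasurable
    ?_ ?_ ?_).2
  · rwa [integral_const_mul] at h
  · refine (ae_restrict_iff' measurableSet_Ioi).2 (ae_of_all _ fun y hy t ht => ?_)
    have hy : 0 < y := hy
    have ht0 : 0 < t := hx2.trans ht.1
    rw [norm_mul, Real.norm_eq_abs, Real.norm_of_nonneg (by positivity), ← add_mul, ← add_mul]
    have := rpow_le_rpow_add_rpow_of_mem_Icc (p := c - 1 - 1) (by linarith : 0 < x / 2 + y)
      (by linarith [ht.1] : x / 2 + y ≤ t + y) (by linarith [ht.2] : t + y ≤ 2 * x + y)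
    gcongr
  · exact ((integrableOn_shiftedGamma hs (c - 1) hb hx2).add
      (integrableOn_shiftedGamma hs (c - 1) hb hx3)).const_mul _
  · refine (ae_restrict_iff' measurableSet_Ioi).2 (ae_of_all _ fun y hy t ht => ?_)
    have hy : 0 < y := hy
    have ht0 : 0 < t := hx2.trans ht.1
    have h1 : HasDerivAt (fun t : ℝ => t + y) 1 t := (hasDerivAt_id t).add_const y
    have h2 := ((h1.rpow_const (p := c - 1) (Or.inl (by positivity))).mul_const
      (y ^ (b - 1))).mul_const (Real.exp (-(s * y)))
    exact h2.congr_deriv (by ring)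

/-- Integration by parts, lowering the exponent of `y` instead of that of `x + y`. -/
theorem shiftedGammaIntegral_by_parts {s b x : ℝ} (hs : 0 < s) (c : ℝ) (hb : 1 < b)
    (hx : 0 < x) :
    (c - 1) * shiftedGammaIntegral s (c - 1) b x =
      s * shiftedGammaIntegral s c b x - (b - 1) * shiftedGammaIntegral s c (b - 1) x := by
  have hb0 : 0 < b := by linarith
  have i1 := (integrableOn_shiftedGamma hs (c - 1) hb0 hx).const_mul (c - 1)
  have i2 := (integrableOn_shiftedGamma hs c hb0 hx).const_mul s
  have i3 := (integrableOn_shiftedGamma hs c (by linarith : 0 < b - 1) hx).const_mul (b - 1)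
  have h_integrable := (i1.sub i2).add i3
  have hcont : ContinuousWithinAt
      (fun y : ℝ => (x + y) ^ (c - 1) * y ^ (b - 1) * Real.exp (-(s * y))) (Set.Ici 0) 0 := by
    refine ContinuousAt.continuousWithinAt ?_
    refine ContinuousAt.mul (ContinuousAt.mul ?_ ?_) (by fun_prop)
    · exact ContinuousAt.rpow_const (by fun_prop) (Or.inl (by simpa using hx.ne'))
    · exact ContinuousAt.rpow_const (by fun_prop) (Or.inr (by linarith))
  have hderiv : ∀ y ∈ Set.Ioi (0 : ℝ), HasDerivAt
      (fun y : ℝ => (x + y) ^ (c - 1) * y ^ (b - 1) * Real.exp (-(s * y)))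
      (((c - 1) * ((x + y) ^ (c - 1 - 1) * y ^ (b - 1) * Real.exp (-(s * y)))
        - s * ((x + y) ^ (c - 1) * y ^ (b - 1) * Real.exp (-(s * y))))
        + (b - 1) * ((x + y) ^ (c - 1) * y ^ (b - 1 - 1) * Real.exp (-(s * y)))) y := by
    intro y hy
    have hy : 0 < y := hy
    have h1 : HasDerivAt (fun t : ℝ => x + t) 1 y := (hasDerivAt_id y).const_add x
    have h2 := h1.rpow_const (p := c - 1) (Or.inl (by positivity))
    have h3 := (hasDerivAt_id' y).rpow_const (p := b - 1) (Or.inl hy.ne')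
    have h4 := (((hasDerivAt_id' y).const_mul s).fun_neg).exp
    exact ((h2.mul h3).mul h4).congr_deriv (by simp only [Pi.mul_apply]; ring)
  have hlim : Tendsto (fun y : ℝ => (x + y) ^ (c - 1) * y ^ (b - 1) * Real.exp (-(s * y)))
      atTop (𝓝 0) :=
    tendsto_zero_of_hasDerivAt_of_integrableOn_Ioi (a := 0) hderiv h_integrable
      (integrableOn_shiftedGamma hs c hb0 hx)
  have h := integral_Ioi_of_hasDerivAt_of_tendsto hcont hderiv h_integrable hlim
  have hz : (0 : ℝ) ^ (b - 1) = 0 := Real.zero_rpow (by linarith)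
  rw [integral_add (f := fun y : ℝ => (c - 1) * ((x + y) ^ (c - 1 - 1) * y ^ (b - 1) *
    Real.exp (-(s * y))) - s * ((x + y) ^ (c - 1) * y ^ (b - 1) * Real.exp (-(s * y))))
    (i1.sub i2) i3, integral_sub i1 i2, integral_const_mul, integral_const_mul, integral_const_mul, hz] at h
  simp only [shiftedGammaIntegral]
  linarith

/-- At `x = 0` the integrand is that of a Gamma integral, convergent since `c + b > 1`; the
integrands at `x = 0` and `x = 1` together dominate. -/
theorem tendsto_shiftedGammaIntegral {s c b : ℝ} (hs : 0 < s) (hb : 0 < b) (hcb : 1 < c + b) :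
    Tendsto (shiftedGammaIntegral s c b) (𝓝[>] 0)
      (𝓝 ((1 / s) ^ (c + b - 1) * Real.Gamma (c + b - 1))) := by
  rw [← Real.integral_rpow_mul_exp_neg_mul_Ioi (by linarith : 0 < c + b - 1) hs]
  have i1 := integrableOn_rpow_mul_exp_neg_mul hs (by linarith : 0 < c + b - 1)
  have i2 := integrableOn_shiftedGamma hs c hb one_pos
  have hpow : ∀ y : ℝ, 0 < y → y ^ (c + b - 1 - 1) = y ^ (c - 1) * y ^ (b - 1) := fun y hy => by
    rw [← Real.rpow_add hy]; ring_nf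
  refine tendsto_integral_filter_of_dominated_convergence _
    (Eventually.of_forall fun t => (measurable_shiftedGamma_integrand s c b t).aestronglyMeasurable)
    ?_ (i1.add i2) ?_
  · have : ∀ᶠ x : ℝ in 𝓝[>] 0, x ∈ Set.Ioo (0 : ℝ) 1 := Ioo_mem_nhdsGT one_pos
    filter_upwards [this] with x hx
    refine (ae_restrict_iff' measurableSet_Ioi).2 (ae_of_all _ fun y hy => ?_)
    have hy : 0 < y := hy
    have hx0 := hx.1
    rw [Real.norm_of_nonneg (by positivity)]
    simp only [Pi.add_apply]
    rw [hpow y hy, ← add_mul, ← add_mul]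
    have := rpow_le_rpow_add_rpow_of_mem_Icc (p := c - 1) hy
      (by linarith : y ≤ x + y) (by linarith [hx.2] : x + y ≤ 1 + y)
    gcongr
  · refine (ae_restrict_iff' measurableSet_Ioi).2 (ae_of_all _ fun y hy => ?_)
    have hy : 0 < y := hy
    rw [hpow y hy]
    have : ContinuousAt (fun x : ℝ => (x + y) ^ (c - 1) * y ^ (b - 1) * Real.exp (-(s * y))) 0 := by
      refine ContinuousAt.mul (ContinuousAt.mul ?_ (by fun_prop)) (by fun_prop)
      exact ContinuousAt.rpow_const (by fun_prop) (Or.inl (by simpa using hy.ne'))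
    simpa using this.tendsto.mono_left nhdsWithin_le_nhds

/-! ### Beta integrals and the behaviour of the shifted Gamma integral at zero -/

theorem integral_Ioo_beta {p q : ℝ} (hp : 0 < p) (hq : 0 < q) :
    ∫ v in Set.Ioo (0 : ℝ) 1, v ^ (p - 1) * (1 - v) ^ (q - 1) =
      Real.Gamma p * Real.Gamma q / Real.Gamma (p + q) := by
  have hB := beta_pos hp hq
  have h := lintegral_betaPDF_eq_one hp hq
  rw [lintegral_betaPDF] at h
  have h2 : ∫ v in Set.Ioo (0 : ℝ) 1, 1 / beta p q * v ^ (p - 1) * (1 - v) ^ (q - 1) = 1 := by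
    rw [integral_eq_lintegral_of_nonneg_ae, h, ENNReal.toReal_one]
    · refine ae_restrict_of_forall_mem measurableSet_Ioo fun v hv => ?_
      have h1 := hv.1
      have h2 : 0 < 1 - v := sub_pos.2 hv.2
      simp only [Pi.zero_apply]
      positivity
    · exact Measurable.aestronglyMeasurable (by fun_prop)
  simp_rw [mul_assoc] at h2
  rw [integral_const_mul, one_div, inv_mul_eq_one₀ hB.ne'] at h2
  rw [← h2, beta]

/-- A non-integrable function has Bochner integral zero, whereas the Beta value is positive. -/
theorem integrableOn_Ioo_beta {p q : ℝ} (hp : 0 < p) (hq : 0 < q) :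
    IntegrableOn (fun v : ℝ => v ^ (p - 1) * (1 - v) ^ (q - 1)) (Set.Ioo 0 1) := by
  by_contra h
  have h1 := integral_undef h
  rw [integral_Ioo_beta hp hq] at h1
  have := beta_pos hp hq
  rw [beta] at this
  exact this.ne' h1

/-- The substitution `y = x v / (1 - v)`. -/
theorem integral_Ioi_eq_integral_Ioo_div_one_sub {x : ℝ} (hx : 0 < x) (g : ℝ → ℝ) :
    ∫ y in Set.Ioi (0 : ℝ), g y =
      ∫ v in Set.Ioo (0 : ℝ) 1, x / (1 - v) ^ 2 * g (x * (v / (1 - v))) := by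
  have himg : (fun v : ℝ => x * (v / (1 - v))) '' Set.Ioo 0 1 = Set.Ioi 0 := by
    ext y
    constructor
    · rintro ⟨v, hv, rfl⟩
      have h1 := hv.1
      have h2 : 0 < 1 - v := sub_pos.2 hv.2
      simp only [Set.mem_Ioi]
      positivity
    · intro hy
      have hy : 0 < y := hy
      have hxy : 0 < x + y := by positivity
      refine ⟨y / (x + y), ⟨by positivity, (div_lt_one hxy).2 (by linarith)⟩, ?_⟩
      have : 1 - y / (x + y) = x / (x + y) := by field_simp; ring
      simp only [this]
      field_simp
  have hd : ∀ v ∈ Set.Ioo (0 : ℝ) 1, HasDerivWithinAt (fun v : ℝ => x * (v / (1 - v)))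
      (x / (1 - v) ^ 2) (Set.Ioo 0 1) v := by
    intro v hv
    have h2 : (1 - v) ≠ 0 := (sub_pos.2 hv.2).ne'
    have h3 := (((hasDerivAt_id' v).div ((hasDerivAt_id' v).const_sub 1) h2).const_mul x)
    exact (h3.congr_deriv (by field_simp; ring)).hasDerivWithinAt
  have hinj : Set.InjOn (fun v : ℝ => x * (v / (1 - v))) (Set.Ioo 0 1) := by
    intro v hv w hw h
    have h2 : (1 - v) ≠ 0 := (sub_pos.2 hv.2).ne'
    have h3 : (1 - w) ≠ 0 := (sub_pos.2 hw.2).ne'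
    have h := mul_left_cancel₀ hx.ne' h
    rw [div_eq_div_iff h2 h3] at h
    linarith
  have h := integral_image_eq_integral_abs_deriv_smul measurableSet_Ioo hd hinj g
  rw [himg] at h
  rw [h]
  refine setIntegral_congr_fun measurableSet_Ioo fun v hv => ?_
  have h2 : 0 < 1 - v := sub_pos.2 hv.2
  simp only [smul_eq_mul]
  rw [abs_of_pos (by positivity)]

/-- Scaling pulls out `x^(c+b-1)`; what is left depends on `x` only through the damping factor,
which tends to `1`. -/
theorem shiftedGamma_integrand_subst {x v : ℝ} (s c b : ℝ) (hx : 0 < x)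
    (hv : v ∈ Set.Ioo (0 : ℝ) 1) :
    x / (1 - v) ^ 2 * ((x + x * (v / (1 - v))) ^ (c - 1) * (x * (v / (1 - v))) ^ (b - 1) *
        Real.exp (-(s * (x * (v / (1 - v)))))) =
      x ^ (c + b - 1) * (v ^ (b - 1) * (1 - v) ^ (1 - c - b - 1) *
        Real.exp (-(s * (x * (v / (1 - v)))))) := by
  have h1 := hv.1
  have h2 : 0 < 1 - v := sub_pos.2 hv.2
  have e1 : x + x * (v / (1 - v)) = x * (1 - v)⁻¹ := by field_simp; ring
  have e2 : x * (v / (1 - v)) = x * (v * (1 - v)⁻¹) := by rw [div_eq_mul_inv]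
  have e3 : x / (1 - v) ^ 2 = x ^ (1 : ℝ) * (1 - v) ^ (-2 : ℝ) := by
    rw [Real.rpow_one, Real.rpow_neg h2.le, div_eq_mul_inv]; norm_cast
  have e4 : x ^ (c + b - 1) = x ^ (1 : ℝ) * x ^ (c - 1) * x ^ (b - 1) := by
    rw [← Real.rpow_add hx, ← Real.rpow_add hx]; ring_nf
  have e5 : (1 - v) ^ (1 - c - b - 1) =
      (1 - v) ^ (-2 : ℝ) * (1 - v) ^ (-(c - 1)) * (1 - v) ^ (-(b - 1)) := by
    rw [← Real.rpow_add h2, ← Real.rpow_add h2]; ring_nf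
  have hi : 0 ≤ (1 - v)⁻¹ := by positivity
  rw [e1, Real.mul_rpow hx.le hi, e4, e5, e3]
  nth_rewrite 1 [e2]
  rw [Real.mul_rpow hx.le (by positivity), Real.mul_rpow h1.le hi, Real.inv_rpow h2.le,
    Real.inv_rpow h2.le, ← Real.rpow_neg h2.le, ← Real.rpow_neg h2.le]
  ring

theorem tendsto_exp_neg_mul_nhdsGT_zero (s t : ℝ) :
    Tendsto (fun x : ℝ => Real.exp (-(s * (x * t)))) (𝓝[>] 0) (𝓝 1) := by
  have : ContinuousAt (fun x : ℝ => Real.exp (-(s * (x * t)))) 0 := by fun_prop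
  simpa using this.tendsto.mono_left nhdsWithin_le_nhds

theorem exp_neg_mul_div_one_sub_le_one {s x v : ℝ} (hs : 0 < s) (hx : 0 < x)
    (hv : v ∈ Set.Ioo (0 : ℝ) 1) : Real.exp (-(s * (x * (v / (1 - v))))) ≤ 1 := by
  have h1 := hv.1
  have h2 : 0 < 1 - v := sub_pos.2 hv.2
  rw [Real.exp_le_one_iff, neg_nonpos]
  positivity

/-- A dominated convergence principle for exponentially damped integrals over `(0, 1)`. -/
theorem tendsto_integral_Ioo_mul_exp {s : ℝ} (hs : 0 < s) {h : ℝ → ℝ}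
    (hh : IntegrableOn h (Set.Ioo 0 1)) :
    Tendsto (fun x : ℝ => ∫ v in Set.Ioo (0 : ℝ) 1, h v * Real.exp (-(s * (x * (v / (1 - v))))))
      (𝓝[>] 0) (𝓝 (∫ v in Set.Ioo (0 : ℝ) 1, h v)) := by
  refine tendsto_integral_filter_of_dominated_convergence (fun v => ‖h v‖)
    (Eventually.of_forall fun x => hh.aestronglyMeasurable.mul
      (Measurable.aestronglyMeasurable (by fun_prop))) ?_ hh.norm ?_
  · filter_upwards [self_mem_nhdsWithin] with x hx
    refine ae_restrict_of_forall_mem measurableSet_Ioo fun v hv => ?_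
    rw [norm_mul, Real.norm_of_nonneg (Real.exp_pos _).le]
    exact mul_le_of_le_one_right (norm_nonneg _) (exp_neg_mul_div_one_sub_le_one hs hx hv)
  · refine ae_of_all _ fun v => ?_
    simpa using (tendsto_exp_neg_mul_nhdsGT_zero s (v / (1 - v))).const_mul (h v)

theorem tendsto_rpow_mul_shiftedGammaIntegral {s c b : ℝ} (hs : 0 < s) (hb : 0 < b)
    (hcb : c + b < 1) :
    Tendsto (fun x => x ^ (1 - c - b) * shiftedGammaIntegral s c b x) (𝓝[>] 0)
      (𝓝 (Real.Gamma b * Real.Gamma (1 - c - b) / Real.Gamma (1 - c))) := by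
  have hq : 0 < 1 - c - b := by linarith
  have h := tendsto_integral_Ioo_mul_exp hs (integrableOn_Ioo_beta hb hq)
  rw [integral_Ioo_beta hb hq, show b + (1 - c - b) = 1 - c by ring] at h
  refine h.congr' ?_
  filter_upwards [self_mem_nhdsWithin] with x hx
  have hx : 0 < x := hx
  rw [shiftedGammaIntegral, integral_Ioi_eq_integral_Ioo_div_one_sub hx,
    setIntegral_congr_fun measurableSet_Ioo
      fun v hv => shiftedGamma_integrand_subst s c b hx hv,
    integral_const_mul, ← mul_assoc, ← Real.rpow_add hx,
    show 1 - c - b + (c + b - 1) = 0 by ring, Real.rpow_zero, one_mul]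

/-- A form of l'Hôpital's rule against `log`, proved by monotonicity of `±(h - l log) + (ε/2) log`
near zero. -/
theorem tendsto_div_log_of_tendsto_mul_deriv {h h' : ℝ → ℝ} {l : ℝ}
    (hd : ∀ x, 0 < x → HasDerivAt h (h' x) x)
    (hl : Tendsto (fun x => x * h' x) (𝓝[>] 0) (𝓝 l)) :
    Tendsto (fun x => h x / Real.log x) (𝓝[>] 0) (𝓝 l) := by
  have hlog : Tendsto (fun x => |Real.log x|) (𝓝[>] 0) atTop :=
    tendsto_abs_atBot_atTop.comp Real.tendsto_log_nhdsGT_zero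
  have key : (fun x => h x - l * Real.log x) =o[𝓝[>] 0] Real.log := by
    refine isLittleO_iff.2 fun ε hε => ?_
    have hε2 : 0 < ε / 2 := by positivity
    have h1 := Metric.tendsto_nhds.1 hl (ε / 2) hε2
    obtain ⟨δ, hδ, hδ'⟩ := mem_nhdsGT_iff_exists_Ioo_subset.1 h1
    have hδ : 0 < δ := hδ
    set d := min (δ / 2) 1 with hdd
    have hd0 : 0 < d := by positivity
    have hdδ : d < δ := (min_le_left _ _).trans_lt (by linarith)
    have hd1 : d ≤ 1 := min_le_right _ _
    have hmono : ∀ σ : ℝ, |σ| = 1 → MonotoneOn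
        (fun x => σ * (h x - l * Real.log x) + ε / 2 * Real.log x) (Set.Ioc 0 d) := by
      intro σ hσ
      have hder : ∀ x, 0 < x → HasDerivAt
          (fun x => σ * (h x - l * Real.log x) + ε / 2 * Real.log x)
          (σ * (h' x - l * x⁻¹) + ε / 2 * x⁻¹) x := fun x hx =>
        (((hd x hx).sub ((Real.hasDerivAt_log hx.ne').const_mul l)).const_mul σ).add
          ((Real.hasDerivAt_log hx.ne').const_mul (ε / 2))
      refine monotoneOn_of_deriv_nonneg (convex_Ioc 0 d)
        (fun x hx => (hder x hx.1).continuousAt.continuousWithinAt)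
        (fun x hx => (hder x ?_).differentiableAt.differentiableWithinAt) fun x hx => ?_
      · rw [interior_Ioc] at hx; exact hx.1
      · rw [interior_Ioc] at hx
        have hx0 := hx.1
        rw [(hder x hx0).deriv]
        have h2 : |x * h' x - l| < ε / 2 := by
          simpa [Real.dist_eq] using hδ' ⟨hx.1, hx.2.trans hdδ⟩
        have h3 : |σ * (x * h' x - l)| < ε / 2 := by rwa [abs_mul, hσ, one_mul]
        have h4 : σ * (h' x - l * x⁻¹) + ε / 2 * x⁻¹ =
            x⁻¹ * (σ * (x * h' x - l) + ε / 2) := by field_simp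
        rw [h4]
        have := (abs_lt.1 h3).1
        exact mul_nonneg (by positivity) (by linarith)
    -- `D` bounds the contribution of the endpoint `d`; close to zero it is absorbed by `(ε/2) |log
    -- x|`.
    set D := |h d - l * Real.log d| + ε / 2 * |Real.log d| with hD
    have h5 := hlog.eventually_ge_atTop (D / (ε / 2))
    have h6 : ∀ᶠ x : ℝ in 𝓝[>] 0, x ∈ Set.Ioo 0 d := Ioo_mem_nhdsGT hd0
    filter_upwards [h5, h6] with x hx5 hx
    have m1 := hmono 1 (by simp) (Set.Ioo_subset_Ioc_self hx) ⟨hd0, le_rfl⟩ hx.2.le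
    have m2 := hmono (-1) (by simp) (Set.Ioo_subset_Ioc_self hx) ⟨hd0, le_rfl⟩ hx.2.le
    simp only at m1 m2
    rw [Real.norm_eq_abs, Real.norm_eq_abs]
    rw [div_le_iff₀ hε2] at hx5
    have l1 : Real.log x < 0 := Real.log_neg hx.1 (hx.2.trans_le hd1)
    have l2 : |Real.log x| = -Real.log x := abs_of_neg l1
    have a1 := le_abs_self (h d - l * Real.log d)
    have a2 := neg_abs_le (h d - l * Real.log d)
    have a3 := mul_le_mul_of_nonneg_left (le_abs_self (Real.log d)) hε2.le
    rw [l2] at hx5 ⊢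
    rw [abs_le]
    constructor <;> linarith
  have h7 := key.tendsto_div_nhds_zero.add_const l
  rw [zero_add] at h7
  refine h7.congr' ?_
  filter_upwards [hlog.eventually_gt_atTop 0] with x hx
  have : Real.log x ≠ 0 := abs_pos.1 hx
  field_simp
  ring

/-- The derivative is `-b` times the integral with `c = -b`, in the power-law regime with exponent
`-1`; since `Γ(b + 1) = b Γ(b)`, `x` times the derivative tends to `-1`. -/
theorem tendsto_shiftedGammaIntegral_div_neg_log {s b : ℝ} (hs : 0 < s) (hb : 0 < b) :
    Tendsto (fun x => shiftedGammaIntegral s (1 - b) b x / -Real.log x) (𝓝[>] 0) (𝓝 1) := by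
  have h := tendsto_rpow_mul_shiftedGammaIntegral (c := -b) hs hb (by linarith)
  have hb1 : 1 - -b - b = 1 := by ring
  have hb2 : 1 - -b = b + 1 := by ring
  have hG : Real.Gamma b ≠ 0 := (Real.Gamma_pos_of_pos hb).ne'
  rw [hb1, hb2, Real.Gamma_add_one hb.ne', Real.Gamma_one] at h
  have h2 := tendsto_div_log_of_tendsto_mul_deriv (l := -1)
    (fun x hx => hasDerivAt_shiftedGammaIntegral hs (1 - b) hb hx) (by
      have h3 := h.const_mul (-b)
      rw [show -b * (Real.Gamma b * 1 / (b * Real.Gamma b)) = -1 by field_simp] at h3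
      refine h3.congr fun x => ?_
      rw [Real.rpow_one, show 1 - b - 1 = -b by ring]
      ring)
  have h4 := h2.neg
  rw [neg_neg] at h4
  refine h4.congr fun x => ?_
  rw [div_neg]

/-! ### The partial fraction expansion of the cotangent as an integral -/

/-- The pole at `v = 1` cancels: for `-1 < p < 0`, `v^p - 1` lies between `0` and `v^p (1 - v)`. -/
theorem abs_rpow_sub_rpow_div_le {b v : ℝ} (hb0 : 0 < b) (hb1 : b < 1)
    (hv : v ∈ Set.Ioo (0 : ℝ) 1) :
    |(v ^ (b - 1) - v ^ (-b)) / (1 - v)| ≤ v ^ (b - 1) + v ^ (-b) := by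
  have h1 := hv.1
  have h2 : 0 < 1 - v := sub_pos.2 hv.2
  have key : ∀ p : ℝ, -1 < p → p < 0 → 0 ≤ v ^ p - 1 ∧ v ^ p - 1 ≤ v ^ p * (1 - v) := by
    intro p hp hp0
    constructor
    · linarith [Real.one_le_rpow_of_pos_of_le_one_of_nonpos h1 hv.2.le hp0.le]
    · have h3 : v ^ (1 : ℝ) ≤ v ^ (-p) := Real.rpow_le_rpow_of_exponent_ge h1 hv.2.le (by linarith)
      rw [Real.rpow_one] at h3
      have h4 := mul_le_mul_of_nonneg_left h3 (Real.rpow_pos_of_pos h1 p).le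
      rw [← Real.rpow_add h1, add_neg_cancel, Real.rpow_zero] at h4
      linarith
  obtain ⟨p1, p2⟩ := key (b - 1) (by linarith) (by linarith)
  obtain ⟨q1, q2⟩ := key (-b) (by linarith) (by linarith)
  rw [abs_div, abs_of_pos h2, div_le_iff₀ h2, abs_le]
  constructor <;> nlinarith

theorem integrableOn_Ioo_rpow {p : ℝ} (hp : -1 < p) :
    IntegrableOn (fun v : ℝ => v ^ p) (Set.Ioo 0 1) := by
  have := (intervalIntegral.intervalIntegrable_rpow' (a := 0) (b := 1) hp)
  rw [intervalIntegrable_iff_integrableOn_Ioo_of_le zero_le_one] at this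
  exact this

theorem integral_Ioo_rpow {p : ℝ} (hp : -1 < p) :
    ∫ v in Set.Ioo (0 : ℝ) 1, v ^ p = 1 / (p + 1) := by
  rw [← integral_Ioc_eq_integral_Ioo, ← intervalIntegral.integral_of_le zero_le_one,
    integral_rpow (Or.inl hp), Real.one_rpow, Real.zero_rpow (by linarith), sub_zero]

theorem integrableOn_rpow_sub_rpow_div {b : ℝ} (hb0 : 0 < b) (hb1 : b < 1) :
    IntegrableOn (fun v : ℝ => (v ^ (b - 1) - v ^ (-b)) / (1 - v)) (Set.Ioo 0 1) :=
  ((integrableOn_Ioo_rpow (p := b - 1) (by linarith)).add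
    (integrableOn_Ioo_rpow (p := -b) (by linarith))).mono'
    (Measurable.aestronglyMeasurable (by fun_prop))
    (ae_restrict_of_forall_mem measurableSet_Ioo fun _ hv =>
      abs_rpow_sub_rpow_div_le hb0 hb1 hv)

theorem tendsto_sum_cot {b : ℝ} (hb0 : 0 < b) (hb1 : b < 1) :
    Tendsto (fun n : ℕ => ∑ k ∈ Finset.range n, (1 / (k + b) - 1 / (k + 1 - b))) atTop
      (𝓝 (Real.pi * Real.cot (Real.pi * b))) := by
  have hb : (b : ℂ) ∈ Complex.integerComplement := by
    rintro ⟨n, hn⟩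
    have hn : (n : ℝ) = b := by exact_mod_cast hn
    rw [← hn] at hb0 hb1
    norm_cast at hb0 hb1
    omega
  have h1 := (summable_cotTerm hb).hasSum.tendsto_sum_nat
  simp only [cotTerm] at h1
  rw [← cot_series_rep' hb] at h1
  have h2 : Tendsto (fun n : ℕ => ∑ k ∈ Finset.range n, (1 / (b - (k + 1)) + 1 / (b + (k + 1))))
      atTop (𝓝 (Real.pi * Real.cot (Real.pi * b) - 1 / b)) := by
    have := (Complex.continuous_re.tendsto _).comp h1
    convert this using 2
    · simp only [Function.comp]
      rw [← Complex.ofReal_re (∑ k ∈ Finset.range _, _)]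
      push_cast
      rfl
    · rw [← Complex.ofReal_re (Real.pi * Real.cot (Real.pi * b) - 1 / b)]
      push_cast
      rfl
  -- The cotangent series pairs `b ± (k + 1)`, while the present sum pairs `k + b` with `k + 1 - b`;
  -- the partial sums differ by this boundary term, once `1 / b` is added.
  have h3 : Tendsto (fun n : ℕ => 1 / ((n : ℝ) + b)) atTop (𝓝 0) := by
    simp_rw [one_div]
    exact (tendsto_natCast_atTop_atTop.atTop_add tendsto_const_nhds).inv_tendsto_atTop
  have h4 := (h2.add_const (1 / b)).sub h3
  rw [sub_zero, sub_add_cancel] at h4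
  refine h4.congr fun n => ?_
  have h5 := Finset.sum_range_succ (fun k : ℕ => 1 / ((k : ℝ) + b)) n
  rw [Finset.sum_range_succ'] at h5
  rw [Finset.sum_sub_distrib, Finset.sum_add_distrib]
  have h6 : ∑ k ∈ Finset.range n, 1 / (b - ((k : ℝ) + 1)) =
      -∑ k ∈ Finset.range n, 1 / ((k : ℝ) + 1 - b) := by
    rw [← Finset.sum_neg_distrib]
    refine Finset.sum_congr rfl fun k _ => ?_
    rw [← neg_sub, div_neg]
  have h7 : ∑ k ∈ Finset.range n, 1 / (b + ((k : ℝ) + 1)) =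
      ∑ k ∈ Finset.range n, 1 / (((k + 1 : ℕ) : ℝ) + b) := by
    refine Finset.sum_congr rfl fun k _ => ?_
    push_cast
    ring_nf
  rw [Nat.cast_zero, zero_add] at h5
  rw [h6, h7]
  linarith

/-- Inserting the factor `1 - v^n` turns `1 / (1 - v)` into a finite geometric sum, whose termwise
integral is a partial sum of the cotangent series. -/
theorem integral_rpow_sub_rpow_div_one_sub {b : ℝ} (hb0 : 0 < b) (hb1 : b < 1) :
    ∫ v in Set.Ioo (0 : ℝ) 1, (v ^ (b - 1) - v ^ (-b)) / (1 - v) =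
      Real.pi * Real.cot (Real.pi * b) := by
  refine tendsto_nhds_unique ?_ (tendsto_sum_cot hb0 hb1)
  have h : Tendsto (fun n : ℕ => ∫ v in Set.Ioo (0 : ℝ) 1,
      (1 - v ^ n) * ((v ^ (b - 1) - v ^ (-b)) / (1 - v))) atTop
      (𝓝 (∫ v in Set.Ioo (0 : ℝ) 1, (v ^ (b - 1) - v ^ (-b)) / (1 - v))) := by
    refine tendsto_integral_of_dominated_convergence
      (fun v => ‖(v ^ (b - 1) - v ^ (-b)) / (1 - v)‖)
      (fun n => Measurable.aestronglyMeasurable (by fun_prop))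
      (integrableOn_rpow_sub_rpow_div hb0 hb1).norm (fun n => ?_) ?_
    · refine ae_restrict_of_forall_mem measurableSet_Ioo fun v hv => ?_
      have h1 := pow_le_one₀ (n := n) hv.1.le hv.2.le
      have h2 := pow_nonneg hv.1.le n
      rw [norm_mul, Real.norm_of_nonneg (sub_nonneg.2 h1)]
      exact mul_le_of_le_one_left (norm_nonneg _) (by linarith)
    · refine ae_restrict_of_forall_mem measurableSet_Ioo fun v hv => ?_
      have h1 := tendsto_pow_atTop_nhds_zero_of_lt_one hv.1.le hv.2
      simpa using (h1.const_sub 1).mul_const ((v ^ (b - 1) - v ^ (-b)) / (1 - v))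
  refine h.congr fun n => ?_
  have h_integrable : ∀ k ∈ Finset.range n, IntegrableOn
      (fun v : ℝ => v ^ ((k : ℝ) + b - 1) - v ^ ((k : ℝ) - b)) (Set.Ioo 0 1) := fun k _ => by
    have hk : (0 : ℝ) ≤ k := k.cast_nonneg
    exact (integrableOn_Ioo_rpow (by linarith)).sub (integrableOn_Ioo_rpow (by linarith))
  calc _ = ∫ v in Set.Ioo (0 : ℝ) 1, ∑ k ∈ Finset.range n,
        (v ^ ((k : ℝ) + b - 1) - v ^ ((k : ℝ) - b)) := by
        refine setIntegral_congr_fun measurableSet_Ioo fun v hv => ?_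
        have h2 : 1 - v ≠ 0 := (sub_pos.2 hv.2).ne'
        have h3 : ∀ k ∈ Finset.range n, v ^ ((k : ℝ) + b - 1) - v ^ ((k : ℝ) - b) =
            v ^ k * (v ^ (b - 1) - v ^ (-b)) := fun k _ => by
          rw [add_sub_assoc, sub_eq_add_neg (k : ℝ), Real.rpow_add hv.1, Real.rpow_add hv.1,
            Real.rpow_natCast]
          ring
        rw [Finset.sum_congr rfl h3, ← Finset.sum_mul, geom_sum_eq hv.2.ne, ← neg_sub 1 v,
          ← neg_sub 1 (v ^ n), neg_div_neg_eq]
        ring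
    _ = _ := by
        rw [integral_finsetSum _ h_integrable]
        refine Finset.sum_congr rfl fun k _ => ?_
        have hk : (0 : ℝ) ≤ k := k.cast_nonneg
        rw [integral_sub (integrableOn_Ioo_rpow (by linarith))
          (integrableOn_Ioo_rpow (by linarith)), integral_Ioo_rpow (by linarith),
          integral_Ioo_rpow (by linarith)]
        ring_nf

/-- With `a + b = 1` the scaling factor is `1`, and the non-integrable `1 / (1 - v)` behind each
logarithm cancels in the difference. -/
theorem tendsto_shiftedGammaIntegral_sub {s a b : ℝ} (hs : 0 < s) (ha : 0 < a) (hb : 0 < b)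
    (hab : a + b = 1) :
    Tendsto (fun x => shiftedGammaIntegral s a b x - shiftedGammaIntegral s b a x) (𝓝[>] 0)
      (𝓝 (Real.pi * Real.cot (Real.pi * b))) := by
  have hb1 : b < 1 := by linarith
  rw [← integral_rpow_sub_rpow_div_one_sub hb hb1]
  refine (tendsto_integral_Ioo_mul_exp hs (integrableOn_rpow_sub_rpow_div hb hb1)).congr' ?_
  filter_upwards [self_mem_nhdsWithin] with x hx
  have hx : 0 < x := hx
  rw [shiftedGammaIntegral, shiftedGammaIntegral,
    ← integral_sub (integrableOn_shiftedGamma hs a hb hx) (integrableOn_shiftedGamma hs b ha hx),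
    integral_Ioi_eq_integral_Ioo_div_one_sub hx]
  refine setIntegral_congr_fun measurableSet_Ioo fun v hv => ?_
  have h2 : 0 < 1 - v := sub_pos.2 hv.2
  rw [mul_sub, shiftedGamma_integrand_subst s a b hx hv, shiftedGamma_integrand_subst s b a hx hv,
    show a + b - 1 = 0 by linarith, show b + a - 1 = 0 by linarith,
    show 1 - a - b - 1 = -1 by linarith, show 1 - b - a - 1 = -1 by linarith,
    show a - 1 = -b by linarith, Real.rpow_zero, Real.rpow_neg_one]
  ring

/-! ### The density on a half-line, with a real order parameter -/

/-- The formula for the density of the bilateral Gamma distribution on `(0, ∞)`; the first shape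
parameter may be any real number. -/
noncomputable def bilateralGammaSide (c lp b lm x : ℝ) : ℝ :=
  lp ^ c / Real.Gamma c * (lm ^ b / Real.Gamma b) *
    (Real.exp (-(lp * x)) * shiftedGammaIntegral (lp + lm) c b x)

/-- This is `Γ(c) = (c - 1) Γ(c - 1)`. It survives at `c = 1`, where `Real.Gamma 0 = 0` and division
by zero give the right value of `1 / Γ`. -/
theorem rpow_div_Gamma_mul_sub_one {r : ℝ} (hr : 0 < r) (c : ℝ) :
    r ^ c / Real.Gamma c * (c - 1) = r * (r ^ (c - 1) / Real.Gamma (c - 1)) := by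
  rcases eq_or_ne c 1 with rfl | hc
  · simp
  · have hc' : c - 1 ≠ 0 := sub_ne_zero.2 hc
    have h1 := Real.Gamma_add_one hc'
    rw [sub_add_cancel] at h1
    have h2 : r ^ c = r * r ^ (c - 1) := by
      rw [mul_comm, ← Real.rpow_add_one hr.ne', sub_add_cancel]
    rw [h1, h2]
    field_simp

theorem hasDerivAt_bilateralGammaSide {lp b lm x : ℝ} (c : ℝ) (hlp : 0 < lp) (hb : 0 < b)
    (hlm : 0 < lm) (hx : 0 < x) :
    HasDerivAt (bilateralGammaSide c lp b lm)
      (lp * (bilateralGammaSide (c - 1) lp b lm x - bilateralGammaSide c lp b lm x)) x := by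
  have h1 := ((hasDerivAt_id' x).const_mul lp).fun_neg.exp
  have h2 := hasDerivAt_shiftedGammaIntegral (add_pos hlp hlm) c hb hx
  refine ((h1.mul h2).const_mul (lp ^ c / Real.Gamma c * (lm ^ b / Real.Gamma b))).congr_deriv ?_
  simp only [bilateralGammaSide]
  linear_combination (lm ^ b / Real.Gamma b) * Real.exp (-(lp * x)) *
    shiftedGammaIntegral (lp + lm) (c - 1) b x * rpow_div_Gamma_mul_sub_one hlp c

/-- Lowering the second parameter lets the two sides of zero obey one common recursion for the jump.
-/
theorem hasDerivAt_bilateralGammaSide' {lp b lm x : ℝ} (c : ℝ) (hlp : 0 < lp) (hb : 1 < b)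
    (hlm : 0 < lm) (hx : 0 < x) :
    HasDerivAt (bilateralGammaSide c lp b lm)
      (lm * (bilateralGammaSide c lp b lm x - bilateralGammaSide c lp (b - 1) lm x)) x := by
  have h1 := ((hasDerivAt_id' x).const_mul lp).fun_neg.exp
  have h2 := hasDerivAt_shiftedGammaIntegral (add_pos hlp hlm) c (by linarith : 0 < b) hx
  rw [shiftedGammaIntegral_by_parts (add_pos hlp hlm) c hb hx] at h2
  refine ((h1.mul h2).const_mul (lp ^ c / Real.Gamma c * (lm ^ b / Real.Gamma b))).congr_deriv ?_
  simp only [bilateralGammaSide]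
  linear_combination -(lp ^ c / Real.Gamma c) * Real.exp (-(lp * x)) *
    shiftedGammaIntegral (lp + lm) c (b - 1) x * rpow_div_Gamma_mul_sub_one hlm b

theorem contDiffOn_bilateralGammaSide {lp b lm : ℝ} (hlp : 0 < lp) (hb : 0 < b) (hlm : 0 < lm)
    (n : ℕ) (c : ℝ) : ContDiffOn ℝ n (bilateralGammaSide c lp b lm) (Set.Ioi 0) := by
  induction n generalizing c with
  | zero =>
    exact contDiffOn_zero.2 fun x hx =>
      (hasDerivAt_bilateralGammaSide c hlp hb hlm hx).continuousAt.continuousWithinAt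
  | succ n ih =>
    rw [Nat.cast_succ, contDiffOn_succ_iff_deriv_of_isOpen isOpen_Ioi]
    refine ⟨fun x hx => (hasDerivAt_bilateralGammaSide c hlp hb hlm
      hx).differentiableAt.differentiableWithinAt, by simp, ?_⟩
    exact (contDiffOn_const.mul ((ih (c - 1)).sub (ih c))).congr fun x hx =>
      (hasDerivAt_bilateralGammaSide c hlp hb hlm hx).deriv

theorem contDiffAt_bilateralGammaSide {lp b lm x : ℝ} (hlp : 0 < lp) (hb : 0 < b) (hlm : 0 < lm)
    (n : ℕ) (c : ℝ) (hx : 0 < x) : ContDiffAt ℝ n (bilateralGammaSide c lp b lm) x :=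
  (contDiffOn_bilateralGammaSide hlp hb hlm n c).contDiffAt (Ioi_mem_nhds hx)

theorem iteratedDeriv_succ_of_hasDerivAt_mul_sub {f g h : ℝ → ℝ} {k x : ℝ} {n : ℕ}
    (hf : ∀ᶠ t in 𝓝 x, HasDerivAt f (k * (g t - h t)) t)
    (hg : ContDiffAt ℝ n g x) (hh : ContDiffAt ℝ n h x) :
    iteratedDeriv (n + 1) f x = k * (iteratedDeriv n g x - iteratedDeriv n h x) := by
  have h1 : deriv f =ᶠ[𝓝 x] fun t => k * (g t - h t) := hf.mono fun t ht => ht.deriv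
  rw [iteratedDeriv_succ', h1.iteratedDeriv_eq, iteratedDeriv_const_mul_field,
    iteratedDeriv_fun_sub hg hh]

theorem iteratedDeriv_succ_bilateralGammaSide {lp b lm x : ℝ} (hlp : 0 < lp) (hb : 0 < b)
    (hlm : 0 < lm) (n : ℕ) (c : ℝ) (hx : 0 < x) :
    iteratedDeriv (n + 1) (bilateralGammaSide c lp b lm) x =
      lp * (iteratedDeriv n (bilateralGammaSide (c - 1) lp b lm) x
        - iteratedDeriv n (bilateralGammaSide c lp b lm) x) :=
  iteratedDeriv_succ_of_hasDerivAt_mul_sub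
    ((eventually_gt_nhds hx).mono fun _ ht =>
      hasDerivAt_bilateralGammaSide c hlp hb hlm ht)
    (contDiffAt_bilateralGammaSide hlp hb hlm n _ hx)
    (contDiffAt_bilateralGammaSide hlp hb hlm n _ hx)

theorem iteratedDeriv_succ_bilateralGammaSide' {lp b lm x : ℝ} (hlp : 0 < lp) (hb : 1 < b)
    (hlm : 0 < lm) (n : ℕ) (c : ℝ) (hx : 0 < x) :
    iteratedDeriv (n + 1) (bilateralGammaSide c lp b lm) x =
      lm * (iteratedDeriv n (bilateralGammaSide c lp b lm) x
        - iteratedDeriv n (bilateralGammaSide c lp (b - 1) lm) x) :=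
  iteratedDeriv_succ_of_hasDerivAt_mul_sub
    ((eventually_gt_nhds hx).mono fun _ ht =>
      hasDerivAt_bilateralGammaSide' c hlp hb hlm ht)
    (contDiffAt_bilateralGammaSide hlp (by linarith) hlm n _ hx)
    (contDiffAt_bilateralGammaSide hlp (by linarith) hlm n _ hx)

/-! ### Behaviour of the derivatives at zero -/

theorem tendsto_exp_neg_nhdsGT_zero (r : ℝ) :
    Tendsto (fun x : ℝ => Real.exp (-(r * x))) (𝓝[>] 0) (𝓝 1) := by
  simpa using tendsto_exp_neg_mul_nhdsGT_zero r 1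

theorem tendsto_bilateralGammaSide {c lp b lm : ℝ} (hlp : 0 < lp) (hb : 0 < b) (hlm : 0 < lm)
    (hcb : 1 < c + b) :
    Tendsto (bilateralGammaSide c lp b lm) (𝓝[>] 0)
      (𝓝 (lp ^ c / Real.Gamma c * (lm ^ b / Real.Gamma b) *
        ((1 / (lp + lm)) ^ (c + b - 1) * Real.Gamma (c + b - 1)))) := by
  have h := ((tendsto_exp_neg_nhdsGT_zero lp).mul
    (tendsto_shiftedGammaIntegral (add_pos hlp hlm) hb hcb)).const_mul
    (lp ^ c / Real.Gamma c * (lm ^ b / Real.Gamma b))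
  rw [one_mul] at h
  exact h

theorem exists_tendsto_iteratedDeriv_bilateralGammaSide {lp b lm : ℝ} (hlp : 0 < lp) (hb : 0 < b)
    (hlm : 0 < lm) (n : ℕ) (c : ℝ) (hcb : n + 1 < c + b) :
    ∃ l, Tendsto (iteratedDeriv n (bilateralGammaSide c lp b lm)) (𝓝[>] 0) (𝓝 l) := by
  induction n generalizing c with
  | zero =>
    rw [iteratedDeriv_zero]
    exact ⟨_, tendsto_bilateralGammaSide hlp hb hlm (by simpa using hcb)⟩
  | succ n ih =>
    push_cast at hcb
    obtain ⟨l₁, h₁⟩ := ih (c - 1) (by linarith)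
    obtain ⟨l₂, h₂⟩ := ih c (by linarith)
    refine ⟨_, ((h₁.sub h₂).const_mul lp).congr' ?_⟩
    filter_upwards [self_mem_nhdsWithin] with x hx
    exact (iteratedDeriv_succ_bilateralGammaSide hlp hb hlm n c hx).symm

/-- Lowering an integer parameter ends at `0`, where the prefactor `1 / Γ(0)` kills the function;
every `m ≥ 1` has `m + b > 1`, hence a finite limit. -/
theorem exists_tendsto_iteratedDeriv_bilateralGammaSide_natCast {lp b lm : ℝ} (hlp : 0 < lp)
    (hb : 0 < b) (hlm : 0 < lm) (n m : ℕ) :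
    ∃ l, Tendsto (iteratedDeriv n (bilateralGammaSide m lp b lm)) (𝓝[>] 0) (𝓝 l) := by
  induction n generalizing m with
  | zero =>
    rw [iteratedDeriv_zero]
    rcases m with _ | m
    · refine ⟨0, tendsto_const_nhds.congr fun x => ?_⟩
      simp [bilateralGammaSide]
    · refine ⟨_, tendsto_bilateralGammaSide hlp hb hlm ?_⟩
      push_cast
      have : (0 : ℝ) ≤ m := m.cast_nonneg
      linarith
  | succ n ih =>
    rcases m with _ | m
    · have : bilateralGammaSide ((0 : ℕ) : ℝ) lp b lm = fun _ => 0 := by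
        funext x
        simp [bilateralGammaSide]
      rw [this]
      refine ⟨0, tendsto_const_nhds.congr fun x => ?_⟩
      simp
    · obtain ⟨l₁, h₁⟩ := ih m
      obtain ⟨l₂, h₂⟩ := ih (m + 1)
      refine ⟨_, ((h₁.sub h₂).const_mul lp).congr' ?_⟩
      filter_upwards [self_mem_nhdsWithin] with x hx
      rw [iteratedDeriv_succ_bilateralGammaSide hlp hb hlm n _ hx]
      push_cast
      rw [add_sub_cancel_right]

theorem tendsto_rpow_nhdsGT_zero {r : ℝ} (hr : 0 < r) :
    Tendsto (fun x : ℝ => x ^ r) (𝓝[>] 0) (𝓝 0) := by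
  have := (Real.continuousAt_rpow_const 0 r (Or.inr hr.le)).tendsto.mono_left
    (nhdsWithin_le_nhds (s := Set.Ioi 0))
  rwa [Real.zero_rpow hr.ne'] at this

/-- In each step of the recursion only the term with `c - 1` is singular; the other converges, so
the positive power of `x` annihilates it. -/
theorem tendsto_rpow_mul_iteratedDeriv_bilateralGammaSide {lp b lm : ℝ} (hlp : 0 < lp)
    (hb : 0 < b) (hlm : 0 < lm) (n : ℕ) (c : ℝ) (h₁ : n < c + b) (h₂ : c + b < n + 1) :
    Tendsto (fun x => x ^ (n + 1 - c - b) * iteratedDeriv n (bilateralGammaSide c lp b lm) x)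
      (𝓝[>] 0) (𝓝 (lp ^ c * lm ^ b * (Real.Gamma (n + 1 - c - b) /
        (Real.Gamma (c - n) * Real.Gamma (n + 1 - c))))) := by
  induction n generalizing c with
  | zero =>
    have h := ((tendsto_exp_neg_nhdsGT_zero lp).mul (tendsto_rpow_mul_shiftedGammaIntegral
      (add_pos hlp hlm) hb (by simpa using h₂))).const_mul
      (lp ^ c / Real.Gamma c * (lm ^ b / Real.Gamma b))
    have hG : Real.Gamma b ≠ 0 := (Real.Gamma_pos_of_pos hb).ne'
    simp only [Nat.cast_zero, zero_add, sub_zero, iteratedDeriv_zero]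
    convert h using 2
    · simp only [bilateralGammaSide]
      ring
    · field_simp
  | succ n ih =>
    push_cast at h₁ h₂ ⊢
    have h := ih (c - 1) (by linarith) (by linarith)
    obtain ⟨l, hl⟩ := exists_tendsto_iteratedDeriv_bilateralGammaSide hlp hb hlm n c h₁
    have hα : 0 < (n : ℝ) + 1 + 1 - c - b := by linarith
    have h0 := (tendsto_rpow_nhdsGT_zero hα).mul hl
    rw [zero_mul] at h0
    rw [show (n : ℝ) + 1 - (c - 1) - b = n + 1 + 1 - c - b by ring,
      show c - 1 - (n : ℝ) = c - (n + 1) by ring,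
      show (n : ℝ) + 1 - (c - 1) = n + 1 + 1 - c by ring] at h
    have h3 := (h.sub h0).const_mul lp
    have hc : lp ^ c = lp * lp ^ (c - 1) := by
      rw [mul_comm, ← Real.rpow_add_one hlp.ne', sub_add_cancel]
    rw [sub_zero, ← mul_assoc, ← mul_assoc, ← hc] at h3
    refine h3.congr' ?_
    filter_upwards [self_mem_nhdsWithin] with x hx
    rw [iteratedDeriv_succ_bilateralGammaSide hlp hb hlm n _ hx]
    ring

theorem tendsto_neg_log_nhdsGT_zero : Tendsto (fun x => -Real.log x) (𝓝[>] 0) atTop :=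
  tendsto_neg_atBot_atTop.comp Real.tendsto_log_nhdsGT_zero

theorem rpow_div_Gamma_one_sub (b r t : ℝ) :
    r / Real.Gamma (1 - b) * (t / Real.Gamma b) =
      r * t * (Real.sin (Real.pi * b) / Real.pi) := by
  have h := Real.Gamma_mul_Gamma_one_sub b
  rw [div_mul_div_comm, mul_comm (Real.Gamma (1 - b)), h, div_div_eq_mul_div, mul_div_assoc]

theorem tendsto_iteratedDeriv_bilateralGammaSide_div_neg_log {lp b lm : ℝ} (hlp : 0 < lp)
    (hb : 0 < b) (hlm : 0 < lm) (n : ℕ) (c : ℝ) (hcb : c + b = n + 1) :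
    Tendsto (fun x => iteratedDeriv n (bilateralGammaSide c lp b lm) x / -Real.log x)
      (𝓝[>] 0) (𝓝 (lp ^ c * lm ^ b * (Real.sin (Real.pi * b) / Real.pi))) := by
  induction n generalizing c with
  | zero =>
    have hc : c = 1 - b := by rw [Nat.cast_zero] at hcb; linarith
    subst hc
    have h := ((tendsto_exp_neg_nhdsGT_zero lp).mul (tendsto_shiftedGammaIntegral_div_neg_log
      (add_pos hlp hlm) hb)).const_mul
      (lp ^ (1 - b) / Real.Gamma (1 - b) * (lm ^ b / Real.Gamma b))
    rw [one_mul, mul_one, rpow_div_Gamma_one_sub] at h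
    refine h.congr fun x => ?_
    rw [iteratedDeriv_zero, bilateralGammaSide, rpow_div_Gamma_one_sub]
    ring
  | succ n ih =>
    push_cast at hcb
    have h := ih (c - 1) (by linarith)
    obtain ⟨l, hl⟩ := exists_tendsto_iteratedDeriv_bilateralGammaSide hlp hb hlm n c (by linarith)
    have h3 := (h.sub (hl.div_atTop tendsto_neg_log_nhdsGT_zero)).const_mul lp
    have hc : lp ^ c = lp * lp ^ (c - 1) := by
      rw [mul_comm, ← Real.rpow_add_one hlp.ne', sub_add_cancel]
    rw [sub_zero, ← mul_assoc, ← mul_assoc, ← hc] at h3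
    refine h3.congr' ?_
    filter_upwards [self_mem_nhdsWithin] with x hx
    rw [iteratedDeriv_succ_bilateralGammaSide hlp hb hlm n _ hx]
    ring

/-! ### The jump of the derivatives across zero -/

/-- The difference of the `n`-th derivatives of the density at `x` and `-x`, for `0 < x`. -/
noncomputable def bilateralGammaJump (n : ℕ) (a lp b lm x : ℝ) : ℝ :=
  iteratedDeriv n (bilateralGammaSide a lp b lm) x
    - (-1) ^ n * iteratedDeriv n (bilateralGammaSide b lm a lp) x

theorem bilateralGammaJump_comm (n : ℕ) (a lp b lm x : ℝ) :
    bilateralGammaJump n a lp b lm x = -(-1) ^ n * bilateralGammaJump n b lm a lp x := by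
  have h : ((-1 : ℝ) ^ n) * (-1) ^ n = 1 := by rw [← mul_pow]; norm_num
  simp only [bilateralGammaJump]
  linear_combination -(iteratedDeriv n (bilateralGammaSide a lp b lm) x) * h

/-- The parameter `a` is lowered on both sides: as first parameter on the right, and as second,
through integration by parts, on the left. -/
theorem bilateralGammaJump_succ {a lp b lm x : ℝ} (n : ℕ) (ha : 1 < a) (hlp : 0 < lp) (hb : 0 < b)
    (hlm : 0 < lm) (hx : 0 < x) :
    bilateralGammaJump (n + 1) a lp b lm x =
      lp * (bilateralGammaJump n (a - 1) lp b lm x - bilateralGammaJump n a lp b lm x) := by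
  simp only [bilateralGammaJump]
  rw [iteratedDeriv_succ_bilateralGammaSide hlp hb hlm n a hx,
    iteratedDeriv_succ_bilateralGammaSide' hlm ha hlp n b hx, pow_succ]
  ring

theorem tendsto_bilateralGammaJump_zero (n : ℕ) {a lp b lm : ℝ} (ha : 0 < a) (hlp : 0 < lp)
    (hb : 0 < b) (hlm : 0 < lm) (hab : n + 1 < a + b) :
    Tendsto (bilateralGammaJump n a lp b lm) (𝓝[>] 0) (𝓝 0) := by
  induction n generalizing a lp b lm with
  | zero =>
    rw [Nat.cast_zero, zero_add] at hab
    have h := (tendsto_bilateralGammaSide hlp hb hlm hab).sub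
      (tendsto_bilateralGammaSide hlm ha hlp (by linarith : 1 < b + a))
    rw [add_comm b a, add_comm lm lp, mul_comm (lm ^ b / Real.Gamma b), sub_self] at h
    refine h.congr fun x => ?_
    simp [bilateralGammaJump]
  | succ n ih =>
    push_cast at hab
    have key : ∀ {a lp b lm : ℝ}, 1 < a → 0 < lp → 0 < b → 0 < lm → (n : ℝ) + 1 + 1 < a + b →
        Tendsto (bilateralGammaJump (n + 1) a lp b lm) (𝓝[>] 0) (𝓝 0) := by
      intro a lp b lm ha hlp hb hlm hab
      have h := ((ih (by linarith : 0 < a - 1) hlp hb hlm (by linarith)).sub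
        (ih (by linarith : 0 < a) hlp hb hlm (by linarith))).const_mul lp
      rw [sub_zero, mul_zero] at h
      refine h.congr' ?_
      filter_upwards [self_mem_nhdsWithin] with x hx
      exact (bilateralGammaJump_succ n ha hlp hb hlm hx).symm
    -- The recursion needs `a > 1`. Otherwise `b > 1`, and the swap symmetry exchanges the roles.
    rcases lt_or_ge 1 a with h1 | h1
    · exact key h1 hlp hb hlm hab
    · have hn : (0 : ℝ) ≤ n := n.cast_nonneg
      have h := (key (by linarith : 1 < b) hlm ha hlp (by linarith)).const_mul (-(-1) ^ (n + 1))
      rw [mul_zero] at h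
      exact h.congr fun x => (bilateralGammaJump_comm _ _ _ _ _ _).symm

theorem tendsto_bilateralGammaJump_of_add_eq_one {a lp b lm : ℝ} (ha : 0 < a) (hlp : 0 < lp)
    (hb : 0 < b) (hlm : 0 < lm) (hab : a + b = 1) :
    Tendsto (bilateralGammaJump 0 a lp b lm) (𝓝[>] 0)
      (𝓝 (lp ^ a * lm ^ b * Real.cos (Real.pi * b))) := by
  have hs := add_pos hlp hlm
  have ha' : a = 1 - b := by linarith
  have hJ := (tendsto_exp_neg_nhdsGT_zero lp).mul (tendsto_shiftedGammaIntegral_sub hs ha hb hab)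
  -- The two sides carry different exponentials; their difference is `O(x)` and beats the
  -- logarithmic growth of the integral.
  have hE : Tendsto (fun x => (Real.exp (-(lp * x)) - Real.exp (-(lm * x))) *
      shiftedGammaIntegral (lp + lm) b a x) (𝓝[>] 0) (𝓝 0) := by
    have h1 := tendsto_shiftedGammaIntegral_div_neg_log hs ha
    rw [show 1 - a = b by linarith] at h1
    have h2 : Tendsto (fun x => (Real.exp (-(lp * x)) - Real.exp (-(lm * x))) / x) (𝓝[>] 0)
        (𝓝 (-lp - -lm)) := by
      have hd : HasDerivAt (fun x => Real.exp (-(lp * x)) - Real.exp (-(lm * x))) (-lp - -lm) 0 := by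
        have e : ∀ r : ℝ, HasDerivAt (fun x => Real.exp (-(r * x))) (-r) 0 := fun r =>
          (((hasDerivAt_id' (0 : ℝ)).const_mul r).fun_neg.exp).congr_deriv (by simp)
        exact (e lp).sub (e lm)
      have := (hasDerivAt_iff_tendsto_slope.1 hd).mono_left
        (nhdsWithin_mono 0 (fun x (hx : 0 < x) => hx.ne') : 𝓝[>] (0 : ℝ) ≤ 𝓝[≠] 0)
      refine this.congr fun x => ?_
      simp [slope_def_field]
    have h3 : Tendsto (fun x : ℝ => x * -Real.log x) (𝓝[>] 0) (𝓝 0) := by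
      have := (tendsto_log_mul_rpow_nhdsGT_zero one_pos).neg
      rw [neg_zero] at this
      refine this.congr fun x => ?_
      rw [Real.rpow_one]
      ring
    have h4 := (h2.mul h3).mul h1
    rw [mul_zero, zero_mul] at h4
    refine h4.congr' ?_
    filter_upwards [Ioo_mem_nhdsGT one_pos] with x hx
    have hx0 : x ≠ 0 := hx.1.ne'
    have hl : Real.log x ≠ 0 := (Real.log_neg hx.1 hx.2).ne
    field_simp
  have hsin : Real.sin (Real.pi * b) ≠ 0 := by
    refine (Real.sin_pos_of_pos_of_lt_pi (by positivity) ?_).ne'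
    exact mul_lt_of_lt_one_right Real.pi_pos (by linarith)
  have h := (hJ.add hE).const_mul (lp ^ a / Real.Gamma a * (lm ^ b / Real.Gamma b))
  have hval : lp ^ a / Real.Gamma a * (lm ^ b / Real.Gamma b) *
      (1 * (Real.pi * Real.cot (Real.pi * b)) + 0) = lp ^ a * lm ^ b * Real.cos (Real.pi * b) := by
    rw [ha', rpow_div_Gamma_one_sub, Real.cot_eq_cos_div_sin]
    have := Real.pi_ne_zero
    generalize Real.sin (Real.pi * b) = S at hsin ⊢
    field_simp
    ring
  rw [hval] at h
  refine h.congr fun x => ?_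
  simp only [bilateralGammaJump, iteratedDeriv_zero, bilateralGammaSide, pow_zero]
  rw [add_comm lm lp]
  ring

theorem tendsto_bilateralGammaJump (n : ℕ) {a lp b lm : ℝ} (ha : 0 < a) (hlp : 0 < lp)
    (hb : 0 < b) (hlm : 0 < lm) (hab : a + b = n + 1) (ha' : ¬ ∃ m : ℕ, a = m) :
    Tendsto (bilateralGammaJump n a lp b lm) (𝓝[>] 0)
      (𝓝 (lp ^ a * lm ^ b * Real.cos (Real.pi * b))) := by
  induction n generalizing a lp b lm with
  | zero => exact tendsto_bilateralGammaJump_of_add_eq_one ha hlp hb hlm (by simpa using hab)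
  | succ n ih =>
    push_cast at hab
    have key : ∀ {a lp b lm : ℝ}, 1 < a → 0 < lp → 0 < b → 0 < lm → a + b = (n : ℝ) + 1 + 1 →
        (¬ ∃ m : ℕ, a = m) → Tendsto (bilateralGammaJump (n + 1) a lp b lm) (𝓝[>] 0)
          (𝓝 (lp ^ a * lm ^ b * Real.cos (Real.pi * b))) := by
      intro a lp b lm ha hlp hb hlm hab ha'
      have h := ((ih (by linarith : 0 < a - 1) hlp hb hlm (by linarith)
        fun ⟨m, hm⟩ => ha' ⟨m + 1, by push_cast; linarith⟩).sub
        (tendsto_bilateralGammaJump_zero n (by linarith : 0 < a) hlp hb hlm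
          (by linarith))).const_mul lp
      have hc : lp ^ a = lp * lp ^ (a - 1) := by
        rw [mul_comm, ← Real.rpow_add_one hlp.ne', sub_add_cancel]
      rw [sub_zero, ← mul_assoc, ← mul_assoc, ← hc] at h
      refine h.congr' ?_
      filter_upwards [self_mem_nhdsWithin] with x hx
      exact (bilateralGammaJump_succ n ha hlp hb hlm hx).symm
    rcases lt_trichotomy 1 a with h1 | h1 | h1
    · exact key h1 hlp hb hlm hab ha'
    · exact absurd ⟨1, by simp [← h1]⟩ ha'
    · have hn : (0 : ℝ) ≤ n := n.cast_nonneg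
      have h := (key (by linarith : 1 < b) hlm ha hlp (by linarith) fun ⟨m, hm⟩ => ?_).const_mul
        (-(-1) ^ (n + 1))
      · have hcos : Real.cos (Real.pi * a) = -(-1) ^ (n + 1) * Real.cos (Real.pi * b) := by
          rw [show Real.pi * a = ((n + 2 : ℕ) : ℝ) * Real.pi - Real.pi * b by
            push_cast; linear_combination Real.pi * hab, Real.cos_nat_mul_pi_sub, pow_succ]
          ring
        have h2 : ((-1 : ℝ) ^ (n + 1)) * (-1) ^ (n + 1) = 1 := by rw [← mul_pow]; norm_num
        have hval : -(-1) ^ (n + 1) * (lm ^ b * lp ^ a * Real.cos (Real.pi * a)) =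
            lp ^ a * lm ^ b * Real.cos (Real.pi * b) := by
          rw [hcos]
          linear_combination lp ^ a * lm ^ b * Real.cos (Real.pi * b) * h2
        rw [hval] at h
        exact h.congr fun x => (bilateralGammaJump_comm _ _ _ _ _ _).symm
      -- Since `0 < a < 1`, `b` lies strictly between two consecutive integers.
      · have h3 : (m : ℝ) < n + 2 := by linarith
        have h4 : (m : ℝ) > n + 1 := by linarith
        norm_cast at h3 h4
        omega

/-! ### The density and its derivatives away from zero -/

theorem bilateralGammaPDF_eq_side (a lp b lm : ℝ) {x : ℝ} (hx : 0 < x) :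
    bilateralGammaPDF a lp b lm x = bilateralGammaSide a lp b lm x := by
  have h : ∀ y, gammaPDFReal a lp (x + y) * gammaPDFReal b lm y = (Set.Ici (0 : ℝ)).indicator
      (fun y => lp ^ a / Real.Gamma a * (lm ^ b / Real.Gamma b) * Real.exp (-(lp * x)) *
        ((x + y) ^ (a - 1) * y ^ (b - 1) * Real.exp (-((lp + lm) * y)))) y := by
    intro y
    by_cases hy : 0 ≤ y
    · have hxy : 0 ≤ x + y := by positivity
      rw [Set.indicator_of_mem (show y ∈ Set.Ici 0 from hy), gammaPDFReal, gammaPDFReal,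
        if_pos hy, if_pos hxy, show -((lp + lm) * y) = -(lp * y) + -(lm * y) by ring,
        Real.exp_add, show -(lp * (x + y)) = -(lp * x) + -(lp * y) by ring, Real.exp_add]
      ring
    · rw [Set.indicator_of_notMem (by simpa using hy), gammaPDFReal, gammaPDFReal, if_neg hy,
        mul_zero]
  simp only [bilateralGammaPDF, h]
  rw [integral_indicator measurableSet_Ici, integral_Ici_eq_integral_Ioi, integral_const_mul,
    bilateralGammaSide, shiftedGammaIntegral]
  ring

theorem bilateralGammaPDF_neg (a lp b lm x : ℝ) :
    bilateralGammaPDF a lp b lm (-x) = bilateralGammaPDF b lm a lp x := by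
  rw [bilateralGammaPDF, bilateralGammaPDF, ← integral_add_right_eq_self _ x]
  refine integral_congr_ae (ae_of_all _ fun y => ?_)
  simp only
  rw [mul_comm, show -x + (y + x) = y by ring, add_comm y x]

theorem iteratedDeriv_bilateralGammaPDF (n : ℕ) (a lp b lm : ℝ) {x : ℝ} (hx : 0 < x) :
    iteratedDeriv n (bilateralGammaPDF a lp b lm) x =
      iteratedDeriv n (bilateralGammaSide a lp b lm) x :=
  Filter.EventuallyEq.iteratedDeriv_eq n
    ((eventually_gt_nhds hx).mono fun _ ht => bilateralGammaPDF_eq_side a lp b lm ht)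

theorem iteratedDeriv_bilateralGammaPDF_neg (n : ℕ) (a lp b lm : ℝ) {x : ℝ} (hx : 0 < x) :
    iteratedDeriv n (bilateralGammaPDF a lp b lm) (-x) =
      (-1) ^ n * iteratedDeriv n (bilateralGammaSide b lm a lp) x := by
  rw [← iteratedDeriv_bilateralGammaPDF n b lm a lp hx,
    show bilateralGammaPDF b lm a lp = fun t => bilateralGammaPDF a lp b lm (-t) from
      funext fun t => (bilateralGammaPDF_neg a lp b lm t).symm,
    iteratedDeriv_comp_neg, smul_eq_mul, ← mul_assoc, ← mul_pow]
  norm_num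

theorem contDiffOn_bilateralGammaPDF {a lp b lm : ℝ} (ha : 0 < a) (hlp : 0 < lp) (hb : 0 < b)
    (hlm : 0 < lm) (n : ℕ) : ContDiffOn ℝ n (bilateralGammaPDF a lp b lm) {0}ᶜ := by
  intro x hx
  refine ContDiffAt.contDiffWithinAt ?_
  rcases lt_or_gt_of_ne hx with h | h
  · have h1 := (contDiffAt_bilateralGammaSide hlm ha hlp n b (neg_pos.2 h)).comp x
      contDiff_neg.contDiffAt
    refine h1.congr_of_eventuallyEq ((eventually_lt_nhds h).mono fun t ht => ?_)
    rw [Function.comp, ← bilateralGammaPDF_eq_side _ _ _ _ (neg_pos.2 ht), bilateralGammaPDF_neg]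
  · exact (contDiffAt_bilateralGammaSide hlp hb hlm n a h).congr_of_eventuallyEq
      ((eventually_gt_nhds h).mono fun t ht => bilateralGammaPDF_eq_side a lp b lm ht)

/-! ### Constants -/

theorem bilateralGammaOrder_lt {a b : ℝ} (hab : 0 < a + b) :
    (bilateralGammaOrder a b : ℝ) < a + b := by
  rw [bilateralGammaOrder, ← Nat.lt_ceil]
  exact Nat.sub_lt (Nat.ceil_pos.2 hab) one_pos

theorem le_bilateralGammaOrder_add_one (a b : ℝ) : a + b ≤ bilateralGammaOrder a b + 1 := by
  have h : ⌈a + b⌉₊ ≤ bilateralGammaOrder a b + 1 := by rw [bilateralGammaOrder]; omega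
  exact (Nat.le_ceil _).trans (by exact_mod_cast h)

theorem sin_pi_mul_ne_zero_of_not_natCast {a : ℝ} (ha : 0 < a) (h : ¬ ∃ n : ℕ, a = n) :
    Real.sin (a * Real.pi) ≠ 0 := by
  intro h0
  obtain ⟨n, hn⟩ := Real.sin_eq_zero_iff.1 h0
  have hn : (n : ℝ) = a := mul_right_cancel₀ Real.pi_ne_zero hn
  have hn0 : 0 ≤ n := by
    rw [← hn] at ha
    exact_mod_cast ha.le
  lift n to ℕ using hn0
  exact h ⟨n, by rw [← hn]; simp⟩

/-- The sign of `sin (π a)` is `(-1) ^ ⌊a⌋₊`. -/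
theorem neg_one_pow_floor_mul_sin_pos {a : ℝ} (ha : 0 < a) (h : ¬ ∃ n : ℕ, a = n) :
    0 < (-1) ^ ⌊a⌋₊ * Real.sin (Real.pi * a) := by
  have h1 : (⌊a⌋₊ : ℝ) < a := (Nat.floor_le ha.le).lt_of_ne fun h' => h ⟨_, h'.symm⟩
  have h2 := Nat.lt_floor_add_one a
  have h3 := Real.sin_sub_nat_mul_pi (Real.pi * a) ⌊a⌋₊
  rw [← h3]
  have hpi := Real.pi_pos
  apply Real.sin_pos_of_pos_of_lt_pi <;> nlinarith

/-- Euler's reflection formula at `a + b - N` and at `a - N`; the two signs `(-1)^N` cancel. -/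
theorem bilateralGammaC₁_eq {a b : ℝ} (lp lm : ℝ) (hab : bilateralGammaOrder a b < a + b) :
    bilateralGammaC₁ a lp b lm =
      lp ^ a * lm ^ b * (Real.Gamma (bilateralGammaOrder a b + 1 - a - b) /
        (Real.Gamma (a - bilateralGammaOrder a b) *
          Real.Gamma (bilateralGammaOrder a b + 1 - a))) := by
  rw [bilateralGammaC₁]
  generalize bilateralGammaOrder a b = N at *
  have hz := Real.Gamma_mul_Gamma_one_sub (a + b - N)
  have hc := Real.Gamma_mul_Gamma_one_sub (a - N)
  rw [show 1 - (a + b - N) = N + 1 - a - b by ring,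
    show Real.pi * (a + b - N) = (a + b) * Real.pi - N * Real.pi by ring,
    Real.sin_sub_nat_mul_pi] at hz
  rw [show 1 - (a - N) = N + 1 - a by ring,
    show Real.pi * (a - N) = a * Real.pi - N * Real.pi by ring, Real.sin_sub_nat_mul_pi] at hc
  have hG : Real.Gamma (a + b - N) ≠ 0 := (Real.Gamma_pos_of_pos (by linarith)).ne'
  have hpm : ((-1 : ℝ)) ^ N ≠ 0 := pow_ne_zero _ (by norm_num)
  have hpi := Real.pi_ne_zero
  rw [hc, eq_div_of_mul_eq hG ((mul_comm _ _).trans hz)]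
  field_simp

theorem bilateralGammaC₁_ne_zero {a lp b lm : ℝ} (ha : 0 < a) (hlp : 0 < lp) (hb : 0 < b)
    (hlm : 0 < lm) (ha' : ¬ ∃ n : ℕ, a = n) (hab : ¬ ∃ n : ℕ, a + b = n) :
    bilateralGammaC₁ a lp b lm ≠ 0 := by
  have h0 := bilateralGammaOrder_lt (add_pos ha hb)
  have h1 := sin_pi_mul_ne_zero_of_not_natCast ha ha'
  have h2 := sin_pi_mul_ne_zero_of_not_natCast (add_pos ha hb) hab
  have h3 : Real.Gamma (a + b - bilateralGammaOrder a b) ≠ 0 :=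
    (Real.Gamma_pos_of_pos (by linarith)).ne'
  have h4 := (Real.rpow_pos_of_pos hlp a).ne'
  have h5 := (Real.rpow_pos_of_pos hlm b).ne'
  rw [bilateralGammaC₁]
  exact div_ne_zero (mul_ne_zero (mul_ne_zero h4 h5) h1) (mul_ne_zero h3 h2)

/-- The two terms of the symmetric expression coincide, because `cos(π a) = (-1)^(N+1) cos(π b)`. -/
theorem bilateralGammaC₂_eq {a b : ℝ} (lp lm : ℝ) (hab : a + b = bilateralGammaOrder a b + 1) :
    bilateralGammaC₂ a lp b lm = lp ^ a * lm ^ b * Real.cos (Real.pi * b) := by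
  rw [bilateralGammaC₂]
  generalize bilateralGammaOrder a b = N at *
  have hcos : Real.cos (a * Real.pi) = (-1) ^ (N + 1) * Real.cos (b * Real.pi) := by
    rw [show a * Real.pi = ((N + 1 : ℕ) : ℝ) * Real.pi - b * Real.pi by
      push_cast; linear_combination Real.pi * hab, Real.cos_nat_mul_pi_sub]
  have h2 : ((-1 : ℝ) ^ (N + 1)) * (-1) ^ (N + 1) = 1 := by rw [← mul_pow]; norm_num
  rw [hcos, mul_comm Real.pi b]
  linear_combination lp ^ a * lm ^ b / 2 * Real.cos (b * Real.pi) * h2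

/-! ### Slow variation of the logarithm -/

theorem tendsto_neg_log_nhdsNE_zero : Tendsto (fun x => -Real.log x) (𝓝[≠] 0) atTop :=
  tendsto_neg_atBot_atTop.comp Real.tendsto_log_nhdsNE_zero

theorem isSlowlyVaryingAtZero_const_mul_neg_log {k : ℝ} (hk : 0 < k) :
    IsSlowlyVaryingAtZero fun x => k * -Real.log x := by
  refine ⟨by fun_prop, ?_, fun c hc => ?_⟩
  · filter_upwards [tendsto_neg_log_nhdsNE_zero.eventually_gt_atTop 0] with x hx
    positivity
  · have h := ((tendsto_const_nhds (x := -Real.log c)).div_atTop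
      tendsto_neg_log_nhdsNE_zero).const_add 1
    rw [add_zero] at h
    refine h.congr' ?_
    filter_upwards [tendsto_neg_log_nhdsNE_zero.eventually_gt_atTop 0, self_mem_nhdsWithin]
      with x hx hx0
    have hl : Real.log x ≠ 0 := fun h0 => by simp [h0] at hx
    rw [Real.log_mul hc.ne' hx0, mul_div_mul_left _ _ hk.ne']
    field_simp
    ring

/-- The sign `(-1)^n` from the reflection is compensated by `sin(π a) = (-1)^n sin(π b)`, and
`Real.log` is even, so both one-sided limits agree. -/
theorem tendsto_iteratedDeriv_bilateralGammaPDF_div_neg_log {a lp b lm : ℝ} (ha : 0 < a)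
    (hlp : 0 < lp) (hb : 0 < b) (hlm : 0 < lm) (n : ℕ) (hab : a + b = n + 1) :
    Tendsto (fun x => iteratedDeriv n (bilateralGammaPDF a lp b lm) x / -Real.log x)
      (𝓝[≠] 0) (𝓝 (lp ^ a * lm ^ b * (Real.sin (Real.pi * b) / Real.pi))) := by
  rw [← Set.Iio_union_Ioi, nhdsWithin_union, tendsto_sup]
  constructor
  · have h := (tendsto_iteratedDeriv_bilateralGammaSide_div_neg_log hlm ha hlp n b
      (by linarith)).const_mul ((-1) ^ n)
    have hsin : Real.sin (Real.pi * a) = (-1) ^ n * Real.sin (Real.pi * b) := by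
      rw [show Real.pi * a = ((n + 1 : ℕ) : ℝ) * Real.pi - Real.pi * b by
        push_cast; linear_combination Real.pi * hab, Real.sin_nat_mul_pi_sub, pow_succ]
      ring
    have h2 : ((-1 : ℝ) ^ n) * (-1) ^ n = 1 := by rw [← mul_pow]; norm_num
    have hval : (-1) ^ n * (lm ^ b * lp ^ a * (Real.sin (Real.pi * a) / Real.pi)) =
        lp ^ a * lm ^ b * (Real.sin (Real.pi * b) / Real.pi) := by
      rw [hsin]
      linear_combination lp ^ a * lm ^ b * Real.sin (Real.pi * b) / Real.pi * h2
    rw [hval] at h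
    have hneg : Tendsto (fun x : ℝ => -x) (𝓝[<] 0) (𝓝[>] 0) := by
      simpa using tendsto_neg_nhdsLT (a := (0 : ℝ))
    refine (h.comp hneg).congr' ?_
    filter_upwards [self_mem_nhdsWithin] with x hx
    have := iteratedDeriv_bilateralGammaPDF_neg n a lp b lm (neg_pos.2 hx)
    rw [neg_neg] at this
    rw [this, Function.comp, Real.log_neg_eq_log]
    ring
  · refine (tendsto_iteratedDeriv_bilateralGammaSide_div_neg_log hlp hb hlm n a hab).congr' ?_
    filter_upwards [self_mem_nhdsWithin] with x hx
    rw [iteratedDeriv_bilateralGammaPDF n a lp b lm hx]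

theorem theorem6p1 (αp lp αm lm : ℝ)
    (hαp : 0 < αp) (hlp : 0 < lp) (hαm : 0 < αm) (hlm : 0 < lm)
    (f : ℝ → ℝ) (hf : f = bilateralGammaPDF αp lp αm lm)
    (N : ℕ) (hN : N = bilateralGammaOrder αp αm) :
    -- the derivatives below are genuine ones
    ContDiffOn ℝ N f {0}ᶜ ∧
    -- first part
    ((∃ l : ℝ, Tendsto (iteratedDeriv N f) (𝓝[>] 0) (𝓝 l)) ↔ ∃ n : ℕ, αp = n) ∧
    -- second part
    ((¬ ∃ n : ℕ, αp = n) → (¬ ∃ n : ℕ, αp + αm = n) →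
      bilateralGammaC₁ αp lp αm lm ≠ 0 ∧
      (N + 1 - αp - αm) ∈ Set.Ioo (0 : ℝ) 1 ∧
      iteratedDeriv N f ~[𝓝[>] 0]
        fun x => bilateralGammaC₁ αp lp αm lm / x ^ (N + 1 - αp - αm)) ∧
    -- third part
    ((¬ ∃ n : ℕ, αp = n) → (∃ n : ℕ, αp + αm = n) →
      (∃ M : ℝ → ℝ, IsSlowlyVaryingAtZero M ∧ Tendsto M (𝓝[≠] 0) atTop ∧
        iteratedDeriv N f ~[𝓝[≠] 0] fun x => (-1) ^ ⌊αm⌋₊ * M x) ∧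
      Tendsto (fun x => iteratedDeriv N f x - iteratedDeriv N f (-x)) (𝓝[>] 0)
        (𝓝 (bilateralGammaC₂ αp lp αm lm))) := by
  have hlt : (N : ℝ) < αp + αm := hN ▸ bilateralGammaOrder_lt (add_pos hαp hαm)
  have hle : αp + αm ≤ N + 1 := hN ▸ le_bilateralGammaOrder_add_one αp αm
  have hlt' : (¬ ∃ n : ℕ, αp + αm = n) → αp + αm < N + 1 := fun h =>
    hle.lt_of_ne fun h' => h ⟨N + 1, by push_cast; exact h'⟩
  have heq : (∃ n : ℕ, αp + αm = n) → αp + αm = N + 1 := by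
    rintro ⟨n, hn⟩
    rw [hn] at hlt hle ⊢
    have : N < n := by exact_mod_cast hlt
    have : n ≤ N + 1 := by exact_mod_cast hle
    have : n = N + 1 := by omega
    rw [this]
    push_cast
    rfl
  have hfs : ∀ x, 0 < x → iteratedDeriv N f x =
      iteratedDeriv N (bilateralGammaSide αp lp αm lm) x := fun x hx => by
    rw [hf, iteratedDeriv_bilateralGammaPDF N αp lp αm lm hx]
  have hpower : (¬ ∃ n : ℕ, αp + αm = n) →
      Tendsto (fun x => x ^ (N + 1 - αp - αm) * iteratedDeriv N f x) (𝓝[>] 0)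
        (𝓝 (bilateralGammaC₁ αp lp αm lm)) := by
    intro hab
    have h := tendsto_rpow_mul_iteratedDeriv_bilateralGammaSide hlp hαm hlm N αp hlt (hlt' hab)
    rw [bilateralGammaC₁_eq lp lm (hN ▸ hlt), ← hN]
    refine h.congr' ?_
    filter_upwards [self_mem_nhdsWithin] with x hx
    rw [hfs x hx]
  have hlog : (∃ n : ℕ, αp + αm = n) → Tendsto (fun x => iteratedDeriv N f x / -Real.log x)
      (𝓝[≠] 0) (𝓝 (lp ^ αp * lm ^ αm * (Real.sin (Real.pi * αm) / Real.pi))) := fun hab => by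
    rw [hf]
    exact tendsto_iteratedDeriv_bilateralGammaPDF_div_neg_log hαp hlp hαm hlm N (heq hab)
  have hαm' : (¬ ∃ n : ℕ, αp = n) → (∃ n : ℕ, αp + αm = n) → ¬ ∃ n : ℕ, αm = n := by
    rintro h ⟨n, hn⟩ ⟨m, hm⟩
    have hmn : m ≤ n := by
      have : (m : ℝ) ≤ n := by linarith
      exact_mod_cast this
    exact h ⟨n - m, by rw [Nat.cast_sub hmn]; linarith⟩
  have hLpos : 0 < lp ^ αp * lm ^ αm :=
    mul_pos (Real.rpow_pos_of_pos hlp _) (Real.rpow_pos_of_pos hlm _)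
  refine ⟨hf ▸ contDiffOn_bilateralGammaPDF hαp hlp hαm hlm N, ⟨?_, ?_⟩, ?_, ?_⟩
  -- A finite limit would force the leading coefficient, of the logarithm or of the power, to
  -- vanish.
  · rintro ⟨l, hl⟩
    by_contra ha
    by_cases hab : ∃ n : ℕ, αp + αm = n
    · have h1 := (hlog hab).mono_left
        (nhdsWithin_mono 0 (fun x (hx : 0 < x) => hx.ne') : 𝓝[>] (0 : ℝ) ≤ 𝓝[≠] 0)
      have h2 := tendsto_nhds_unique h1 (hl.div_atTop tendsto_neg_log_nhdsGT_zero)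
      have h3 := neg_one_pow_floor_mul_sin_pos hαm (hαm' ha hab)
      have h4 := right_ne_zero_of_mul h3.ne'
      exact mul_ne_zero hLpos.ne' (div_ne_zero h4 Real.pi_ne_zero) h2
    · have h0 := (tendsto_rpow_nhdsGT_zero
        (by linarith [hlt' hab] : 0 < (N : ℝ) + 1 - αp - αm)).mul hl
      rw [zero_mul] at h0
      exact bilateralGammaC₁_ne_zero hαp hlp hαm hlm ha hab (tendsto_nhds_unique (hpower hab) h0)
  · rintro ⟨n, rfl⟩
    obtain ⟨l, hl⟩ := exists_tendsto_iteratedDeriv_bilateralGammaSide_natCast hlp hαm hlm N n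
    refine ⟨l, hl.congr' ?_⟩
    filter_upwards [self_mem_nhdsWithin] with x hx
    exact (hfs x hx).symm
  · intro ha hab
    have hC := bilateralGammaC₁_ne_zero hαp hlp hαm hlm ha hab
    refine ⟨hC, ⟨by linarith [hlt' hab], by linarith⟩, ?_⟩
    refine (isEquivalent_iff_tendsto_one ?_).2 ?_
    · filter_upwards [self_mem_nhdsWithin] with x hx
      exact div_ne_zero hC (Real.rpow_pos_of_pos hx _).ne'
    · have h := (hpower hab).div_const (bilateralGammaC₁ αp lp αm lm)
      rw [div_self hC] at h
      refine h.congr fun x => ?_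
      rw [Pi.div_apply, div_div_eq_mul_div, mul_comm]
  · intro ha hab
    have hpos := neg_one_pow_floor_mul_sin_pos hαm (hαm' ha hab)
    have hsq : ((-1 : ℝ) ^ ⌊αm⌋₊) * (-1) ^ ⌊αm⌋₊ = 1 := by rw [← mul_pow]; norm_num
    -- `k` is the absolute value of the coefficient of `-log x`, so that `M = -k log |x|` is
    -- positive near zero.
    set k := lp ^ αp * lm ^ αm * ((-1) ^ ⌊αm⌋₊ * Real.sin (Real.pi * αm) / Real.pi) with hk
    have hkpos : 0 < k := mul_pos hLpos (div_pos hpos Real.pi_pos)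
    refine ⟨⟨fun x => k * -Real.log x, isSlowlyVaryingAtZero_const_mul_neg_log hkpos,
      tendsto_neg_log_nhdsNE_zero.const_mul_atTop hkpos, ?_⟩, ?_⟩
    · have hval : lp ^ αp * lm ^ αm * (Real.sin (Real.pi * αm) / Real.pi) =
          (-1) ^ ⌊αm⌋₊ * k := by
        rw [hk]
        linear_combination -(lp ^ αp * lm ^ αm * Real.sin (Real.pi * αm) / Real.pi) * hsq
      have hk0 : (-1) ^ ⌊αm⌋₊ * k ≠ 0 := mul_ne_zero (pow_ne_zero _ (by norm_num)) hkpos.ne'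
      have h := (hlog hab).div_const ((-1) ^ ⌊αm⌋₊ * k)
      rw [hval, div_self hk0] at h
      refine (isEquivalent_iff_tendsto_one ?_).2 (h.congr fun x => ?_)
      · filter_upwards [tendsto_neg_log_nhdsNE_zero.eventually_gt_atTop 0] with x hx
        rw [← mul_assoc]
        exact mul_ne_zero hk0 hx.ne'
      · rw [Pi.div_apply, div_div]
        congr 1
        ring
    · rw [bilateralGammaC₂_eq lp lm (hN ▸ heq hab)]
      refine (tendsto_bilateralGammaJump N hαp hlp hαm hlm (heq hab) ha).congr' ?_
      filter_upwards [self_mem_nhdsWithin] with x hx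
      rw [hfs x hx, hf, iteratedDeriv_bilateralGammaPDF_neg N αp lp αm lm hx, bilateralGammaJump]
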